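/- For a unital associative ring $R$, let a cover of $R$ be a collection of proper subrings of $R$ (not required to contain the identity of $R$, nor to have an identity) whose union is $R$, and let $\sigma(R)$ be the minimal number of subrings in a cover of $R$, with $\sigma(R)=\infty$ if $R$ has no finite cover. For a prime power $q$ let $F_q$ be the field with $q$ elements, let $M_2(F_2)$ be the ring of all $2\times 2$ matrices over $F_2$, and let $T_2(F_3)$ be the ring of upper triangular $2\times 2$ matrices over $F_3$. Theorem. A unital ring $R$ (finite or infinite, commutative or not) satisfies $\sigma(R)=4$ if and only if $\sigma(R)\neq 3$ and $R$ has a quotient ring $R/I$, with $I$ a two-sided ideal, that is isomorphic to one of $$F_4\times F_4,\qquad M_2(F_2),\qquad F_3[x,y]/(x^2,xy,y^2),\qquad T_2(F_3).$$ -/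

import Mathlib

/-- A cover of the ring `R`: a collection of proper subrings, not required to contain `1`,
whose union is `R`. -/
def IsRingCover (R : Type*) [Ring R] (C : Set (NonUnitalSubring R)) : Prop :=
  (∀ S ∈ C, S ≠ ⊤) ∧ (⋃ S ∈ C, (S : Set R)) = Set.univ

/-- The covering number `σ(R)`: the minimal size of a cover of `R`, which is `⊤` if `R` has no
cover or no finite cover. -/
noncomputable def coveringNumber (R : Type*) [Ring R] : ℕ∞ :=
  ⨅ (C : Set (NonUnitalSubring R)) (_ : IsRingCover R C), C.encard

/-- `R` has a quotient by a two-sided ideal that is isomorphic, as a ring, to `A`. -/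
def HasQuotientIso (R : Type*) [Ring R] (A : Type*) [Ring A] : Prop :=
  ∃ (I : Ideal R) (_ : I.IsTwoSided), Nonempty ((R ⧸ I) ≃+* A)

/-- The ring `T₂(F)` of upper triangular `2 × 2` matrices. -/
abbrev UpperTriangularTwo (F : Type*) [CommRing F] : Type _ :=
  Matrix.blockTriangularSubalgebra F F (id : Fin 2 → Fin 2)

/-- The ring `F[x, y] / (x², xy, y²)`. -/
abbrev TruncatedPolynomialTwo (F : Type*) [CommRing F] : Type _ :=
  MvPolynomial (Fin 2) F ⧸
    (Ideal.span {MvPolynomial.X 0 ^ 2, MvPolynomial.X 0 * MvPolynomial.X 1,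
      MvPolynomial.X 1 ^ 2} : Ideal (MvPolynomial (Fin 2) F))

/-! Each of the four rings is a union of four proper subrings, covers pull back along surjections,
and no group is a union of two proper subgroups; this settles one direction.

Conversely, take a cover by four subrings when no three suffice. Neumann's inequality on reciprocal
indices in coset covers, sharpened inside a member of prime index, leaves two cases
(`index_of_irredundant_four_cover`): all members have index 3, or two have index 2.

Index 3: the members contain D = S₀ ∩ S₁ and are the four lines of the plane R/D over F₃
(`SubringPencil`). D acts on this plane from the left and right by scalars λ and ρ, it contains 1,
and the elements of D with λ = ρ = 0 form a two-sided ideal K. Modulo K, if λ ≠ ρ, an idempotent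
with triangular Peirce decomposition gives T₂(F₃). If λ = ρ, then R/K has a basis 1, a, b, and
associativity leaves a two-parameter multiplication table (`ThreeDimTable`): the truncated
polynomial ring when both parameters vanish, T₂(F₃) otherwise.

Index 2: the members turn out to contain 1. A unital subring of index 2 is the kernel of a matrix
coefficient of a two-dimensional representation over F₂ (`indexTwoRep`). Unless three subrings
suffice or M₂(F₂) is a quotient, this coefficient is a derivation along a character or a coordinate
of a map onto F₄ (`index_two_cases`). Two derivations would give a cover by three subrings, two
coordinates give F₄ × F₄, and one of each forces a third member of index 2. -/

/-! ### Covers, their pullbacks, and the lower bound 3. -/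

section Cover

variable {R : Type*} [Ring R]

/-- The kernel of an additive map, as a subring, when it is closed under multiplication. -/
def kerSubring {B : Type*} [AddCommGroup B] (f : R →+ B)
    (h : ∀ x y, f x = 0 → f y = 0 → f (x * y) = 0) : NonUnitalSubring R :=
  { f.ker with
    mul_mem' := fun {a b} ha hb => h a b ha hb }

theorem mem_kerSubring {B : Type*} [AddCommGroup B] {f : R →+ B}
    {h : ∀ x y, f x = 0 → f y = 0 → f (x * y) = 0} {x : R} :
    x ∈ kerSubring f h ↔ f x = 0 := Iff.rfl

theorem kerSubring_ne_top {B : Type*} [AddCommGroup B] {f : R →+ B}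
    {h : ∀ x y, f x = 0 → f y = 0 → f (x * y) = 0} {x : R} (hx : f x ≠ 0) :
    kerSubring f h ≠ ⊤ := fun H => hx (mem_kerSubring.1 (H ▸ NonUnitalSubring.mem_top x))

theorem coveringNumber_le_of_cover {n : ℕ} (S : Fin n → NonUnitalSubring R)
    (hS : ∀ i, S i ≠ ⊤) (hc : ∀ x, ∃ i, x ∈ S i) : coveringNumber R ≤ n := by
  refine (iInf₂_le (Set.range S) ⟨?_, ?_⟩).trans ?_
  · rw [← Set.image_univ]
    refine (Set.encard_image_le _ _).trans ?_
    simp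
  · rintro _ ⟨i, rfl⟩
    exact hS i
  · ext x
    simpa using hc x

theorem exists_cover_of_coveringNumber_eq {n : ℕ} (h : coveringNumber R = n) :
    ∃ S : Fin n → NonUnitalSubring R, (∀ i, S i ≠ ⊤) ∧ ∀ x, ∃ i, x ∈ S i := by
  obtain ⟨C, hC, hn⟩ : ∃ C, IsRingCover R C ∧ C.encard ≤ n := by
    by_contra! H
    have : ((n + 1 : ℕ) : ℕ∞) ≤ coveringNumber R :=
      le_iInf₂ fun C hC => by
        have := Order.add_one_le_of_lt (H C hC)
        exact_mod_cast this
    rw [h] at this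
    have := Nat.cast_le.1 this
    omega
  have hn' : C.encard = n := le_antisymm hn (h ▸ iInf₂_le C hC)
  have hf : C.Finite := Set.finite_of_encard_eq_coe hn'
  have : Fintype C := hf.fintype
  have hcard : Fintype.card C = n := by
    have := hn'
    rw [Set.encard_eq_coe_toFinset_card] at this
    rw [← Set.toFinset_card]
    exact_mod_cast this
  let e := Fintype.equivFinOfCardEq hcard
  refine ⟨fun i => (e.symm i : NonUnitalSubring R), fun i => hC.1 _ (e.symm i).2, fun x => ?_⟩
  have hx : x ∈ ⋃ S ∈ C, (S : Set R) := hC.2 ▸ Set.mem_univ x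
  simp only [Set.mem_iUnion] at hx
  obtain ⟨S, hS, hx⟩ := hx
  exact ⟨e ⟨S, hS⟩, by simpa using hx⟩

/-- Two proper subgroups never suffice: the sum of an element of A ∖ B and one of B ∖ A lies in
neither. -/
theorem three_le_coveringNumber : 3 ≤ coveringNumber R := by
  refine le_iInf₂ fun C hC => ?_
  have cov (x : R) : ∃ S ∈ C, x ∈ S := by
    have hx : x ∈ ⋃ S ∈ C, (S : Set R) := hC.2 ▸ Set.mem_univ x
    simpa using hx
  have out (S : NonUnitalSubring R) (hS : S ∈ C) : ∃ x, x ∉ S := by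
    by_contra! H
    exact hC.1 S hS (eq_top_iff.2 fun x _ => H x)
  obtain ⟨A, hA, -⟩ := cov 0
  obtain ⟨x, hx⟩ := out A hA
  obtain ⟨B, hB, hxB⟩ := cov x
  obtain ⟨y, hyA, hyB⟩ : ∃ y, y ∉ A ∧ y ∉ B := by
    by_cases hAB : A ≤ B
    · obtain ⟨y, hy⟩ := out B hB
      exact ⟨y, fun h => hy (hAB h), hy⟩
    · obtain ⟨a, ha, haB⟩ := SetLike.not_le_iff_exists.1 hAB
      refine ⟨a + x, fun h => hx ?_, fun h => haB ?_⟩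
      · simpa using A.sub_mem h ha
      · simpa using B.sub_mem h hxB
  obtain ⟨D, hD, hyD⟩ := cov y
  have h1 : A ≠ B := by rintro rfl; exact hx hxB
  have h2 : A ≠ D := by rintro rfl; exact hyA hyD
  have h3 : B ≠ D := by rintro rfl; exact hyB hyD
  have : ({A, B, D} : Set (NonUnitalSubring R)).encard = 3 :=
    Set.encard_eq_three.2 ⟨A, B, D, h1, h2, h3, rfl⟩
  rw [← this]
  refine Set.encard_le_encard ?_
  rintro S (rfl | rfl | rfl) <;> assumption

theorem hasQuotientIso_of_surjective {A : Type*} [Ring A] (f : R →+* A)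
    (hf : Function.Surjective f) : HasQuotientIso R A :=
  ⟨RingHom.ker f, inferInstance, ⟨RingHom.quotientKerEquivOfSurjective hf⟩⟩

theorem HasQuotientIso.exists_surjective {A : Type*} [Ring A] (h : HasQuotientIso R A) :
    ∃ f : R →+* A, Function.Surjective f := by
  obtain ⟨I, hI, ⟨e⟩⟩ := h
  exact ⟨(e : R ⧸ I →+* A).comp (Ideal.Quotient.mk I),
    e.surjective.comp Ideal.Quotient.mk_surjective⟩

theorem HasQuotientIso.coveringNumber_le {A : Type*} [Ring A] (h : HasQuotientIso R A) {n : ℕ}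
    (S : Fin n → NonUnitalSubring A) (hS : ∀ i, S i ≠ ⊤) (hc : ∀ x, ∃ i, x ∈ S i) :
    coveringNumber R ≤ n := by
  obtain ⟨f, hf⟩ := h.exists_surjective
  refine coveringNumber_le_of_cover (fun i => (S i).comap (f : R →ₙ+* A)) (fun i H => hS i ?_)
    (fun x => hc (f x))
  refine eq_top_iff.2 fun a _ => ?_
  obtain ⟨x, rfl⟩ := hf a
  have : x ∈ (S i).comap (f : R →ₙ+* A) := H ▸ NonUnitalSubring.mem_top x
  exact this

end Cover

/-! ### Explicit covers of the four rings. -/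

section CoversOfSmallRings

/-- The linear parts form a plane over F₃, the union of its four lines; scalars plus a line form a
subring. The map `g` serves to read off linear coefficients. -/
theorem coveringNumber_le_four_of_truncated {R : Type*} [Ring R]
    (h : HasQuotientIso R (TruncatedPolynomialTwo (ZMod 3))) : coveringNumber R ≤ 4 := by
  obtain ⟨g, hg⟩ : ∃ g : TruncatedPolynomialTwo (ZMod 3) →+*
      TrivSqZeroExt (ZMod 3) (ZMod 3 × ZMod 3), g (Ideal.Quotient.mk _ (MvPolynomial.X 0)) =
        TrivSqZeroExt.inr (1, 0) ∧ g (Ideal.Quotient.mk _ (MvPolynomial.X 1)) =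
        TrivSqZeroExt.inr (0, 1) := by
    let v : Fin 2 → TrivSqZeroExt (ZMod 3) (ZMod 3 × ZMod 3) :=
      ![TrivSqZeroExt.inr (1, 0), TrivSqZeroExt.inr (0, 1)]
    refine ⟨Ideal.Quotient.lift _ (MvPolynomial.aeval (R := ZMod 3) v :
      MvPolynomial (Fin 2) (ZMod 3) →+* _) ?_, ?_, ?_⟩
    · intro a ha
      rw [← RingHom.mem_ker]
      refine (Ideal.span_le.2 ?_ : _ ≤ RingHom.ker _) ha
      rintro _ (rfl | rfl | rfl) <;> simp [RingHom.mem_ker, v, pow_two]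
    · simp [v]
    · simp [v]
  let α (s t : ZMod 3) : TruncatedPolynomialTwo (ZMod 3) →+ ZMod 3 :=
    { toFun := fun x => s * (g x).snd.1 + t * (g x).snd.2
      map_zero' := by simp
      map_add' := fun x y => by simp; ring }
  have hα (s t : ZMod 3) (x y) (hx : α s t x = 0) (hy : α s t y = 0) : α s t (x * y) = 0 := by
    simp only [α, AddMonoidHom.coe_mk, ZeroHom.coe_mk, map_mul, TrivSqZeroExt.snd_mul,
      Prod.fst_add, Prod.snd_add, Prod.smul_fst, Prod.smul_snd, smul_eq_mul,
      MulOpposite.smul_eq_mul_unop, MulOpposite.unop_op] at hx hy ⊢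
    linear_combination (g x).fst * hy + (g y).fst * hx
  refine h.coveringNumber_le (n := 4) ![kerSubring (α 1 0) (hα 1 0), kerSubring (α 0 1) (hα 0 1),
    kerSubring (α 1 1) (hα 1 1), kerSubring (α 1 (-1)) (hα 1 (-1))] ?_ ?_
  · intro i
    fin_cases i
    · exact kerSubring_ne_top (x := Ideal.Quotient.mk _ (MvPolynomial.X 0)) (by simp [α, hg])
    · exact kerSubring_ne_top (x := Ideal.Quotient.mk _ (MvPolynomial.X 1)) (by simp [α, hg])
    · exact kerSubring_ne_top (x := Ideal.Quotient.mk _ (MvPolynomial.X 0)) (by simp [α, hg])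
    · exact kerSubring_ne_top (x := Ideal.Quotient.mk _ (MvPolynomial.X 0)) (by simp [α, hg])
  · intro x
    have key : ∀ a b : ZMod 3, a = 0 ∨ b = 0 ∨ a + b = 0 ∨ a - b = 0 := by decide
    rcases key (g x).snd.1 (g x).snd.2 with h | h | h | h
    · exact ⟨0, by simp [mem_kerSubring, α, h]⟩
    · exact ⟨1, by simp [mem_kerSubring, α, h]⟩
    · exact ⟨2, by simpa [mem_kerSubring, α] using h⟩
    · exact ⟨3, by simpa [mem_kerSubring, α, sub_eq_add_neg] using h⟩

/-- Each `α s t` satisfies α(xy) = x₀₀ α(y) + α(x) y₁₁, so its kernel is a subring; the four kernels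
correspond to the four lines of F₃². -/
theorem coveringNumber_le_four_of_upperTriangular {R : Type*} [Ring R]
    (h : HasQuotientIso R (UpperTriangularTwo (ZMod 3))) : coveringNumber R ≤ 4 := by
  let α (s t : ZMod 3) : UpperTriangularTwo (ZMod 3) →+ ZMod 3 :=
    { toFun := fun x => s * x.1 0 1 + t * (x.1 0 0 - x.1 1 1)
      map_zero' := by simp
      map_add' := fun x y => by simp; ring }
  have h10 (x : UpperTriangularTwo (ZMod 3)) : x.1 1 0 = 0 := x.2 (by simp)
  have hα (s t : ZMod 3) (x y) (hx : α s t x = 0) (hy : α s t y = 0) : α s t (x * y) = 0 := by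
    simp only [α, AddMonoidHom.coe_mk, ZeroHom.coe_mk, MulMemClass.coe_mul, Matrix.mul_apply,
      Fin.sum_univ_two, h10] at hx hy ⊢
    linear_combination x.1 0 0 * hy + y.1 1 1 * hx
  let E01 : UpperTriangularTwo (ZMod 3) := ⟨!![0, 1; 0, 0], by
    intro i j hij; fin_cases i <;> fin_cases j <;> simp_all⟩
  let E00 : UpperTriangularTwo (ZMod 3) := ⟨!![1, 0; 0, 0], by
    intro i j hij; fin_cases i <;> fin_cases j <;> simp_all⟩
  refine h.coveringNumber_le (n := 4) ![kerSubring (α 1 0) (hα 1 0), kerSubring (α 0 1) (hα 0 1),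
    kerSubring (α 1 1) (hα 1 1), kerSubring (α 1 (-1)) (hα 1 (-1))] ?_ ?_
  · intro i
    fin_cases i
    · exact kerSubring_ne_top (x := E01) (by simp [α, E01])
    · exact kerSubring_ne_top (x := E00) (by simp [α, E00])
    · exact kerSubring_ne_top (x := E01) (by simp [α, E01])
    · exact kerSubring_ne_top (x := E01) (by simp [α, E01])
  · intro x
    have key : ∀ a b : ZMod 3, a = 0 ∨ b = 0 ∨ a + b = 0 ∨ a - b = 0 := by decide
    rcases key (x.1 0 1) (x.1 0 0 - x.1 1 1) with h | h | h | h
    · exact ⟨0, by simp [mem_kerSubring, α, h]⟩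
    · exact ⟨1, by simp [mem_kerSubring, α, h]⟩
    · exact ⟨2, by simpa [mem_kerSubring, α] using h⟩
    · exact ⟨3, by simp [mem_kerSubring, α]; linear_combination h⟩

/-- A matrix with an eigenvalue in F₂ stabilises one of the three lines of F₂²; the others lie in
the field F₂[J] of order 4, the centraliser of `J`. -/
theorem coveringNumber_le_four_of_matrix {R : Type*} [Ring R]
    (h : HasQuotientIso R (Matrix (Fin 2) (Fin 2) (ZMod 2))) : coveringNumber R ≤ 4 := by
  let α : Matrix (Fin 2) (Fin 2) (ZMod 2) →+ ZMod 2 :=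
    { toFun := fun x => x 0 1, map_zero' := by simp, map_add' := fun _ _ => by simp }
  let β : Matrix (Fin 2) (Fin 2) (ZMod 2) →+ ZMod 2 :=
    { toFun := fun x => x 1 0, map_zero' := by simp, map_add' := fun _ _ => by simp }
  let γ : Matrix (Fin 2) (Fin 2) (ZMod 2) →+ ZMod 2 :=
    { toFun := fun x => x 0 0 + x 0 1 - (x 1 0 + x 1 1)
      map_zero' := by simp
      map_add' := fun _ _ => by simp; ring }
  let J : Matrix (Fin 2) (Fin 2) (ZMod 2) := !![0, 1; 1, 1]
  let δ : Matrix (Fin 2) (Fin 2) (ZMod 2) →+ Matrix (Fin 2) (Fin 2) (ZMod 2) :=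
    { toFun := fun x => x * J - J * x
      map_zero' := by simp
      map_add' := fun _ _ => by simp [add_mul, mul_add]; abel }
  have hα x y (hx : α x = 0) (hy : α y = 0) : α (x * y) = 0 := by
    change x 0 1 = 0 at hx
    change y 0 1 = 0 at hy
    change (x * y) 0 1 = 0
    simp [Matrix.mul_apply, hx, hy]
  have hβ x y (hx : β x = 0) (hy : β y = 0) : β (x * y) = 0 := by
    change x 1 0 = 0 at hx
    change y 1 0 = 0 at hy
    change (x * y) 1 0 = 0
    simp [Matrix.mul_apply, hx, hy]
  have hγ x y (hx : γ x = 0) (hy : γ y = 0) : γ (x * y) = 0 := by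
    simp only [γ, AddMonoidHom.coe_mk, ZeroHom.coe_mk, Matrix.mul_apply, Fin.sum_univ_two]
      at hx hy ⊢
    linear_combination (y 1 0 + y 1 1) * hx + (x 0 0 - x 1 0) * hy
  have hδ x y (hx : δ x = 0) (hy : δ y = 0) : δ (x * y) = 0 := by
    simp only [δ, AddMonoidHom.coe_mk, ZeroHom.coe_mk, sub_eq_zero] at hx hy ⊢
    rw [mul_assoc, hy, ← mul_assoc, hx, mul_assoc]
  refine h.coveringNumber_le (n := 4) ![kerSubring α hα, kerSubring β hβ, kerSubring γ hγ,
    kerSubring δ hδ] ?_ ?_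
  · intro i
    fin_cases i
    · exact kerSubring_ne_top (x := !![0, 1; 0, 0]) (show (1 : ZMod 2) ≠ 0 by decide)
    · exact kerSubring_ne_top (x := !![0, 0; 1, 0]) (show (1 : ZMod 2) ≠ 0 by decide)
    · exact kerSubring_ne_top (x := !![1, 0; 0, 0]) (by simp [γ])
    · refine kerSubring_ne_top (x := !![1, 0; 0, 0]) fun H => ?_
      have := congrFun (congrFun H 0) 1
      simp [δ, J] at this
  · intro x
    have key : ∀ a b c d : ZMod 2, b = 0 ∨ c = 0 ∨ a + b - (c + d) = 0 ∨
        !![a, b; c, d] * J - J * !![a, b; c, d] = 0 := by decide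
    rcases key (x 0 0) (x 0 1) (x 1 0) (x 1 1) with h | h | h | h
    · exact ⟨0, h⟩
    · exact ⟨1, h⟩
    · exact ⟨2, h⟩
    · rw [← Matrix.eta_fin_two x] at h
      exact ⟨3, h⟩

theorem GaloisField.four_eq (x : GaloisField 2 2) : x = 0 ∨ x = 1 ∨ x ^ 2 + x + 1 = 0 := by
  have : Finite (GaloisField 2 2) := inferInstance
  have : Fintype (GaloisField 2 2) := Fintype.ofFinite _
  have hc : Fintype.card (GaloisField 2 2) = 4 := by
    rw [← Nat.card_eq_fintype_card, GaloisField.card 2 2 (by norm_num)]; norm_num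
  have h := FiniteField.pow_card x
  rw [hc] at h
  have h' : x * ((x - 1) * (x ^ 2 + x + 1)) = 0 := by linear_combination h
  simpa [sub_eq_zero] using h'

theorem GaloisField.exists_root_four : ∃ w : GaloisField 2 2, w ^ 2 + w + 1 = 0 := by
  by_contra! H
  have h : ∀ x : GaloisField 2 2, x = 0 ∨ x = 1 := fun x => by
    have := GaloisField.four_eq x
    have := H x
    tauto
  have hc : Nat.card (GaloisField 2 2) = 4 := by
    rw [GaloisField.card 2 2 (by norm_num)]; norm_num
  have hs : (Set.univ : Set (GaloisField 2 2)) ⊆ {0, 1} := fun x _ => h x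
  have := Set.ncard_le_ncard hs (by simp)
  rw [Set.ncard_univ, hc] at this
  have h2 := Set.ncard_insert_le (0 : GaloisField 2 2) {1}
  rw [Set.ncard_singleton] at h2
  omega

/-- The subrings are F₂ × F₄, F₄ × F₂, the diagonal and the graph of Frobenius: if x and y both lie
outside F₂, then y is x or x². -/
theorem coveringNumber_le_four_of_galoisField {R : Type*} [Ring R]
    (h : HasQuotientIso R (GaloisField 2 2 × GaloisField 2 2)) : coveringNumber R ≤ 4 := by
  set F := GaloisField 2 2
  have h2 : (2 : F) = 0 := CharTwo.two_eq_zero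
  let α : F × F →+ F :=
    { toFun := fun x => x.1 ^ 2 - x.1
      map_zero' := by simp
      map_add' := fun x y => by simp only [Prod.fst_add]; linear_combination x.1 * y.1 * h2 }
  let β : F × F →+ F :=
    { toFun := fun x => x.2 ^ 2 - x.2
      map_zero' := by simp
      map_add' := fun x y => by simp only [Prod.snd_add]; linear_combination x.2 * y.2 * h2 }
  let γ : F × F →+ F :=
    { toFun := fun x => x.1 - x.2
      map_zero' := by simp
      map_add' := fun x y => by simp only [Prod.fst_add, Prod.snd_add]; ring }
  let δ : F × F →+ F :=
    { toFun := fun x => x.1 ^ 2 - x.2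
      map_zero' := by simp
      map_add' := fun x y => by
        simp only [Prod.fst_add, Prod.snd_add]; linear_combination x.1 * y.1 * h2 }
  have hα x y (hx : α x = 0) (hy : α y = 0) : α (x * y) = 0 := by
    simp only [α, AddMonoidHom.coe_mk, ZeroHom.coe_mk, Prod.fst_mul] at hx hy ⊢
    linear_combination y.1 ^ 2 * hx + x.1 * hy
  have hβ x y (hx : β x = 0) (hy : β y = 0) : β (x * y) = 0 := by
    simp only [β, AddMonoidHom.coe_mk, ZeroHom.coe_mk, Prod.snd_mul] at hx hy ⊢
    linear_combination y.2 ^ 2 * hx + x.2 * hy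
  have hγ x y (hx : γ x = 0) (hy : γ y = 0) : γ (x * y) = 0 := by
    simp only [γ, AddMonoidHom.coe_mk, ZeroHom.coe_mk, Prod.snd_mul, Prod.fst_mul] at hx hy ⊢
    linear_combination y.1 * hx + x.2 * hy
  have hδ x y (hx : δ x = 0) (hy : δ y = 0) : δ (x * y) = 0 := by
    simp only [δ, AddMonoidHom.coe_mk, ZeroHom.coe_mk, Prod.snd_mul, Prod.fst_mul] at hx hy ⊢
    linear_combination y.1 ^ 2 * hx + x.2 * hy
  obtain ⟨w, hw⟩ := GaloisField.exists_root_four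
  have hw' : w ^ 2 - w ≠ 0 := fun H => one_ne_zero (α := F) (by linear_combination hw - H - w * h2)
  refine h.coveringNumber_le (n := 4) ![kerSubring α hα, kerSubring β hβ, kerSubring γ hγ,
    kerSubring δ hδ] ?_ ?_
  · intro i
    fin_cases i
    · exact kerSubring_ne_top (x := (w, w)) hw'
    · exact kerSubring_ne_top (x := (w, w)) hw'
    · exact kerSubring_ne_top (x := (1, 0)) (by simp [γ])
    · exact kerSubring_ne_top (x := (1, 0)) (by simp [δ])
  · rintro ⟨x, y⟩
    rcases GaloisField.four_eq x with rfl | rfl | hx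
    · exact ⟨0, by simp [mem_kerSubring, α]⟩
    · exact ⟨0, by simp [mem_kerSubring, α]⟩
    rcases GaloisField.four_eq y with rfl | rfl | hy
    · exact ⟨1, by simp [mem_kerSubring, β]⟩
    · exact ⟨1, by simp [mem_kerSubring, β]⟩
    have : (x - y) * (x ^ 2 - y) = 0 := by
      linear_combination (x - 1 - y) * hx + hy
    rcases mul_eq_zero.1 this with h | h
    · exact ⟨2, h⟩
    · exact ⟨3, h⟩

end CoversOfSmallRings

/-! ### Indices in irredundant covers of abelian groups. -/

section GroupCover

variable {G : Type*} [AddCommGroup G]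

/-- The case `n = 0` is infinite index, whose reciprocal is rightly 0. -/
theorem inv_natCast_le_inv_of_le {n m : ℕ} (hm : 0 < m) (h : n = 0 ∨ m ≤ n) :
    (n : ℚ)⁻¹ ≤ (m : ℚ)⁻¹ := by
  rcases h with rfl | h
  · simp
  · exact inv_anti₀ (by exact_mod_cast hm) (by exact_mod_cast h)

theorem AddSubgroup.sup_eq_top_of_prime_index {H K : AddSubgroup G} (hH : H.index.Prime)
    (hK : ¬ K ≤ H) : H ⊔ K = ⊤ := by
  have hle : H ≤ H ⊔ K := le_sup_left
  rcases (Nat.dvd_prime hH).1 (AddSubgroup.index_dvd_of_le hle) with h | h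
  · exact AddSubgroup.index_eq_one.1 h
  · have := AddSubgroup.relIndex_mul_index hle
    rw [h] at this
    have h1 : H.relIndex (H ⊔ K) = 1 := Nat.eq_of_mul_eq_mul_right hH.pos (by rw [this, one_mul])
    exact absurd (le_sup_right.trans (AddSubgroup.relIndex_eq_one.1 h1)) hK

open scoped Pointwise in
/-- A member of prime index in an irredundant cover: the others already satisfy the
coset-covering inequality. -/
theorem one_le_sum_erase_inv_index {ι : Type*} [Fintype ι] [DecidableEq ι]
    (H : ι → AddSubgroup G) (hc : ∀ x, ∃ i, x ∈ H i)
    (hirr : ∀ i, ∃ y, ∀ j, j ≠ i → y ∉ H j) {i : ι} (hi : (H i).index.Prime) :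
    1 ≤ ∑ j ∈ Finset.univ.erase i, ((H j).index : ℚ)⁻¹ := by
  have hsup (j) (hj : j ≠ i) : H i ⊔ H j = ⊤ := by
    refine AddSubgroup.sup_eq_top_of_prime_index hi fun hle => ?_
    obtain ⟨y, hy⟩ := hirr j
    obtain ⟨k, hk⟩ := hc y
    obtain rfl : k = j := by
      by_contra h
      exact hy k h hk
    exact hy i (Ne.symm hj) (hle hk)
  have hidx (j) (hj : j ≠ i) : ((H j).addSubgroupOf (H i)).index = (H j).index := by
    rw [← AddSubgroup.relIndex_top_right (H j), ← hsup j hj, AddSubgroup.relIndex_sup_right]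
    rfl
  -- The coset of `a` misses `H i`, so the other members cover it; translated back into `H i`, each
  -- contributes one coset of its intersection with `H i`, of the same index as in `G`.
  obtain ⟨a, ha⟩ : ∃ a, a ∉ H i := by
    by_contra! h
    exact hi.ne_one (AddSubgroup.index_eq_one.2 (eq_top_iff.2 fun x _ => h x))
  have hb (j) : ∃ b : H i, j ≠ i → (b : G) + a ∈ H j := by
    by_cases hj : j = i
    · exact ⟨0, fun h => absurd hj h⟩
    · have : a ∈ H i ⊔ H j := by rw [hsup j hj]; exact AddSubgroup.mem_top a
      obtain ⟨y, hy, z, hz, h⟩ := AddSubgroup.mem_sup.1 this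
      refine ⟨⟨-y, (H i).neg_mem hy⟩, fun _ => ?_⟩
      rw [← h]
      simpa using hz
  choose b hb using hb
  have hcov : ⋃ j ∈ Finset.univ.erase i, b j +ᵥ ((H j).addSubgroupOf (H i) : Set (H i)) =
      Set.univ := by
    refine Set.eq_univ_of_forall fun s => ?_
    obtain ⟨j, hj⟩ := hc (s + a)
    have hji : j ≠ i := by
      rintro rfl
      exact ha (by simpa using (H j).sub_mem hj s.2)
    simp only [Set.mem_iUnion]
    refine ⟨j, by simpa using hji, ?_⟩
    rw [Set.mem_vadd_set_iff_neg_vadd_mem]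
    change ((-b j + s : H i) : G) ∈ H j
    have := (H j).sub_mem hj (hb j hji)
    push_cast
    convert this using 1
    abel
  have := AddSubgroup.one_le_sum_inv_index_of_leftCoset_cover hcov
  refine this.trans_eq (Finset.sum_congr rfl fun j hj => ?_)
  rw [hidx j (Finset.ne_of_mem_erase hj)]

open scoped Pointwise in
/-- A cover by four subgroups of which no three suffice has two members of index `2`,
or all its members have index `3`. -/
theorem index_of_irredundant_four_cover (H : Fin 4 → AddSubgroup G) (hc : ∀ x, ∃ i, x ∈ H i)
    (hirr : ∀ i, ∃ y, ∀ j, j ≠ i → y ∉ H j) :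
    (∃ i j, i ≠ j ∧ (H i).index = 2 ∧ (H j).index = 2) ∨ ∀ i, (H i).index = 3 := by
  classical
  have hone (i) : (H i).index ≠ 1 := fun h => by
    rw [AddSubgroup.index_eq_one] at h
    obtain ⟨j, hj⟩ : ∃ j : Fin 4, j ≠ i := exists_ne i
    obtain ⟨y, hy⟩ := hirr j
    exact hy i (Ne.symm hj) (h ▸ AddSubgroup.mem_top y)
  have hprime (i) (hi : (H i).index = 2 ∨ (H i).index = 3) :=
    one_le_sum_erase_inv_index H hc hirr (i := i) (by
      rcases hi with hi | hi <;> rw [hi] <;> norm_num)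
  -- Three reciprocals, each at most 1/3, with sum at least 1 must all equal 1/3.
  have hthree (i : Fin 4) (hi : (H i).index = 2 ∨ (H i).index = 3)
      (h2 : ∀ j, j ≠ i → (H j).index ≠ 2) : ∀ j, j ≠ i → (H j).index = 3 := by
    intro j hj
    by_contra h3
    have hlt : ∑ j ∈ Finset.univ.erase i, ((H j).index : ℚ)⁻¹ <
        ∑ j ∈ Finset.univ.erase i, (3 : ℚ)⁻¹ := by
      refine Finset.sum_lt_sum (fun k hk => ?_) ⟨j, by simpa using hj, ?_⟩
      · have := h2 k (Finset.ne_of_mem_erase hk)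
        have := hone k
        exact_mod_cast inv_natCast_le_inv_of_le (m := 3) (by norm_num) (by omega)
      · have := h2 j hj
        have := hone j
        have : ((H j).index : ℚ)⁻¹ ≤ ((4 : ℕ) : ℚ)⁻¹ :=
          inv_natCast_le_inv_of_le (by norm_num) (by omega)
        refine this.trans_lt (by norm_num)
    rw [Finset.sum_const, Finset.card_erase_of_mem (Finset.mem_univ i)] at hlt
    have := (hprime i hi).trans_lt hlt
    norm_num at this
  -- Otherwise all four reciprocals are at most 1/4, so equality holds in Neumann's inequality and
  -- the members are disjoint; but all contain 0.
  obtain ⟨i, hi⟩ : ∃ i, (H i).index = 2 ∨ (H i).index = 3 := by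
    by_contra! hno
    have hcov : ⋃ j ∈ (Finset.univ : Finset (Fin 4)), (0 : G) +ᵥ (H j : Set G) = Set.univ := by
      refine Set.eq_univ_of_forall fun s => ?_
      simpa using hc s
    have hge := AddSubgroup.one_le_sum_inv_index_of_leftCoset_cover hcov
    have hle (k) : ((H k).index : ℚ)⁻¹ ≤ (4 : ℚ)⁻¹ := by
      have := hno k
      have := hone k
      exact_mod_cast inv_natCast_le_inv_of_le (m := 4) (by norm_num) (by omega)
    have hsum : ∑ j : Fin 4, ((H j).index : ℚ)⁻¹ = 1 := by
      refine le_antisymm ?_ hge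
      refine (Finset.sum_le_sum fun k _ => hle k).trans ?_
      simp
    have heq (k) : ((H k).index : ℚ)⁻¹ = (4 : ℚ)⁻¹ := by
      refine le_antisymm (hle k) ?_
      by_contra hlt
      have : ∑ j : Fin 4, ((H j).index : ℚ)⁻¹ < ∑ j : Fin 4, (4 : ℚ)⁻¹ :=
        Finset.sum_lt_sum (fun k _ => hle k) ⟨k, Finset.mem_univ k, not_le.1 hlt⟩
      rw [hsum] at this
      norm_num at this
    have hfin (k) : (H k).FiniteIndex := ⟨fun h => by
      have := heq k
      rw [h] at this
      norm_num at this⟩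
    have hdisj := AddSubgroup.pairwiseDisjoint_leftCoset_cover_of_sum_neg_index_eq_zero hcov hsum
    have := hdisj (x := 0) (by simp [hfin]) (y := 1) (by simp [hfin]) (by decide)
    exact Set.disjoint_left.1 this (show (0 : G) ∈ _ by simp) (by simp)
  by_cases h2 : ∃ i, (H i).index = 2
  · obtain ⟨i, hi⟩ := h2
    left
    by_contra! hno
    have h3 := hthree i (Or.inl hi) fun j hj h => hno i j (Ne.symm hj) hi h
    obtain ⟨a, ha⟩ : ∃ a, a ∉ H i := by
      by_contra! h
      exact hone i (AddSubgroup.index_eq_one.2 (eq_top_iff.2 fun x _ => h x))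
    obtain ⟨r, hr⟩ := hirr i
    have hmem (x : G) : 2 • x ∈ H i := hi ▸ (H i).nsmul_index_mem x
    -- This element is congruent to `r` modulo every member of index 3 and to `a` modulo `H i`, so
    -- nothing covers it.
    obtain ⟨j, hj⟩ := hc (r + 3 • (r + a))
    by_cases hji : j = i
    · subst hji
      refine ha ?_
      have := (H j).sub_mem hj (hmem (2 • r + a))
      convert this using 1
      abel
    · refine hr j hji ?_
      have h3' : 3 • (r + a) ∈ H j := h3 j hji ▸ (H j).nsmul_index_mem (r + a)
      simpa using (H j).sub_mem hj h3'
  · push Not at h2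
    right
    have hi3 := hi.resolve_left (h2 i)
    intro j
    by_cases hj : j = i
    · exact hj ▸ hi3
    · exact hthree i hi (fun j _ => h2 j) j hj

end GroupCover

/-! ### Unital subrings of index 2. -/

section IndexTwo

variable {R : Type*} [Ring R]

/-- `R` is the union of three proper subrings. -/
def HasThreeCover (R : Type*) [Ring R] : Prop :=
  ∃ A B C : NonUnitalSubring R, A ≠ ⊤ ∧ B ≠ ⊤ ∧ C ≠ ⊤ ∧ ∀ x, x ∈ A ∨ x ∈ B ∨ x ∈ C

theorem HasThreeCover.coveringNumber_le (h : HasThreeCover R) : coveringNumber R ≤ 3 := by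
  obtain ⟨A, B, C, hA, hB, hC, hc⟩ := h
  refine coveringNumber_le_of_cover (n := 3) ![A, B, C] (fun i => ?_) fun x => ?_
  · fin_cases i <;> assumption
  · rcases hc x with h | h | h
    exacts [⟨0, h⟩, ⟨1, h⟩, ⟨2, h⟩]

theorem ZMod.two_cases (x : ZMod 2) : x = 0 ∨ x = 1 := by
  revert x
  decide

theorem hasThreeCover_of_functionals (f g : R →+ ZMod 2) (hf0 : ∃ x, f x ≠ 0)
    (hg0 : ∃ x, g x ≠ 0) (hne : f ≠ g)
    (hf : ∀ x y, f x = 0 → f y = 0 → f (x * y) = 0)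
    (hg : ∀ x y, g x = 0 → g y = 0 → g (x * y) = 0)
    (hfg : ∀ x y, f x = g x → f y = g y → f (x * y) = g (x * y)) : HasThreeCover R := by
  obtain ⟨x, hx⟩ := hf0
  obtain ⟨y, hy⟩ := hg0
  obtain ⟨z, hz⟩ := DFunLike.ne_iff.1 hne
  refine ⟨kerSubring f hf, kerSubring g hg, kerSubring (f - g) fun u v hu hv => ?_,
    kerSubring_ne_top hx, kerSubring_ne_top hy, kerSubring_ne_top (x := z) ?_, fun u => ?_⟩
  · simp only [AddMonoidHom.sub_apply, sub_eq_zero] at hu hv ⊢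
    exact hfg u v hu hv
  · simpa [sub_eq_zero] using hz
  · simp only [mem_kerSubring, AddMonoidHom.sub_apply]
    generalize f u = p
    generalize g u = q
    revert p q
    decide

theorem hasThreeCover_of_ringHom_ne (χ ψ : R →+* ZMod 2) (h : χ ≠ ψ) : HasThreeCover R := by
  refine hasThreeCover_of_functionals (χ : R →+ ZMod 2) (ψ : R →+ ZMod 2) ⟨1, by simp⟩
    ⟨1, by simp⟩ (fun H => h ?_) ?_ ?_ ?_
  · ext x
    exact DFunLike.congr_fun H x
  all_goals
    intro x y hx hy
    simp_all

/-- Two distinct nonzero derivations along the same character give a cover by three subrings. -/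
theorem hasThreeCover_of_derivations (χ : R →+* ZMod 2) (f g : R →+ ZMod 2)
    (hf0 : ∃ x, f x ≠ 0) (hg0 : ∃ x, g x ≠ 0) (hne : f ≠ g)
    (hf : ∀ x y, f (x * y) = χ x * f y + f x * χ y)
    (hg : ∀ x y, g (x * y) = χ x * g y + g x * χ y) : HasThreeCover R := by
  refine hasThreeCover_of_functionals f g hf0 hg0 hne ?_ ?_ ?_ <;> intro x y hx hy <;>
    simp [hf, hg, hx, hy]

-- With X = (u v; w z) and A = (u' 1; w' z'), the hypotheses say that the functional with
-- coefficients p, q, r, p kills A, X, XA and AX. Splitting on p, q, r first keeps each `decide`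
-- small.
set_option synthInstance.maxSize 1000 in
set_option synthInstance.maxHeartbeats 400000 in
set_option maxRecDepth 10000 in
theorem ZMod.matrix_subring_cases : ∀ p q r u' w' z' : ZMod 2, ¬ (p = 0 ∧ q = 0 ∧ r = 0) →
    p * u' + q * 1 + r * w' + p * z' = 0 →
    (∀ u v w z : ZMod 2, p * u + q * v + r * w + p * z = 0 →
      p * (u * u' + v * w') + q * (u * 1 + v * z') + r * (w * u' + z * w') +
        p * (w * 1 + z * z') = 0 →
      p * (u' * u + 1 * w) + q * (u' * v + 1 * z) + r * (w' * u + z' * w) +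
        p * (w' * v + z' * z) = 0 → w = 0) ∨
    (∀ u v w z : ZMod 2, p * u + q * v + r * w + p * z = 0 →
      p * (u * u' + v * w') + q * (u * 1 + v * z') + r * (w * u' + z * w') +
        p * (w * 1 + z * z') = 0 →
      p * (u' * u + 1 * w) + q * (u' * v + 1 * z) + r * (w' * u + z' * w) +
        p * (w' * v + z' * z) = 0 → u + v = w + z) ∨
    (∀ u v w z : ZMod 2, p * u + q * v + r * w + p * z = 0 →
      p * (u * u' + v * w') + q * (u * 1 + v * z') + r * (w * u' + z * w') +
        p * (w * 1 + z * z') = 0 →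
      p * (u' * u + 1 * w) + q * (u' * v + 1 * z) + r * (w' * u + z' * w) +
        p * (w' * v + z' * z) = 0 → w = v ∧ z = u + v) := by
  intro p q r
  rcases ZMod.two_cases p with rfl | rfl <;> rcases ZMod.two_cases q with rfl | rfl <;>
    rcases ZMod.two_cases r with rfl | rfl <;> decide

/-- A ring of `2 × 2` matrices over `𝔽₂` that is not everything and does not stabilise the
second coordinate line stabilises another line or lies in the field of order `4`. -/
theorem matrix_hom_cases (M : R →+* Matrix (Fin 2) (Fin 2) (ZMod 2)) (a : R)
    (ha : M a 0 1 = 1) (hM : ¬ Function.Surjective M) :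
    (∀ x, M x 1 0 = 0) ∨ (∀ x, M x 0 0 + M x 0 1 = M x 1 0 + M x 1 1) ∨
      (∀ x, M x 1 0 = M x 0 1 ∧ M x 1 1 = M x 0 0 + M x 0 1) := by
  -- The image is a proper F₂-subspace, hence killed by a nonzero functional; as it kills 1, its two
  -- diagonal coefficients agree.
  let V : Submodule (ZMod 2) (Matrix (Fin 2) (Fin 2) (ZMod 2)) :=
    AddSubgroup.toZModSubmodule 2 (M : R →+ Matrix (Fin 2) (Fin 2) (ZMod 2)).range
  have hV : V < ⊤ := by
    refine lt_top_iff_ne_top.2 fun h => hM fun m => ?_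
    have : m ∈ V := h ▸ Submodule.mem_top
    simpa [V] using this
  obtain ⟨g, hg0, hg⟩ := Submodule.exists_le_ker_of_lt_top V hV
  have hgM (x) : g (M x) = 0 := hg (by simp [V])
  have hexp (m : Matrix (Fin 2) (Fin 2) (ZMod 2)) : g m =
      g (Matrix.single 0 0 1) * m 0 0 + g (Matrix.single 0 1 1) * m 0 1 +
      g (Matrix.single 1 0 1) * m 1 0 + g (Matrix.single 1 1 1) * m 1 1 := by
    conv_lhs => rw [Matrix.matrix_eq_sum_single m]
    have hs (i j : Fin 2) (c : ZMod 2) :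
        g (Matrix.single i j c) = g (Matrix.single i j 1) * c := by
      rw [mul_comm, ← smul_eq_mul, ← map_smul, Matrix.smul_single, smul_eq_mul, mul_one]
    simp only [Fin.sum_univ_two, map_add]
    rw [hs 0 0, hs 0 1, hs 1 0, hs 1 1]
    ring
  set p := g (Matrix.single 0 0 1)
  set q := g (Matrix.single 0 1 1)
  set r := g (Matrix.single 1 0 1)
  set s := g (Matrix.single 1 1 1)
  have hsp : s = p := by
    have := hgM 1
    rw [map_one, hexp] at this
    simp only [Matrix.one_apply_eq, ne_eq, zero_ne_one, one_ne_zero, not_false_eq_true,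
      Matrix.one_apply_ne, mul_one, mul_zero, add_zero] at this
    revert this
    generalize s = s
    generalize p = p
    revert s p
    decide
  have hpqr : ¬ (p = 0 ∧ q = 0 ∧ r = 0) := by
    rintro ⟨h1, h2, h3⟩
    refine hg0 (LinearMap.ext fun m => ?_)
    rw [hexp, hsp, h1, h2, h3]
    simp
  have E (x) : p * M x 0 0 + q * M x 0 1 + r * M x 1 0 + p * M x 1 1 = 0 := by
    have := hgM x
    rwa [hexp, hsp] at this
  have E1 (x) := E (x * a)
  have E2 (x) := E (a * x)
  simp only [map_mul, Matrix.mul_apply, Fin.sum_univ_two, ha] at E1 E2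
  have Ea := E a
  rw [ha] at Ea
  rcases ZMod.matrix_subring_cases p q r _ _ _ hpqr Ea with h | h | h
  · exact Or.inl fun x => h _ _ _ _ (E x) (E1 x) (E2 x)
  · exact Or.inr (Or.inl fun x => h _ _ _ _ (E x) (E1 x) (E2 x))
  · exact Or.inr (Or.inr fun x => h _ _ _ _ (E x) (E1 x) (E2 x))

/-- If f(s) = 0, then f(s·) vanishes on ker f, so it is a multiple of f, found by evaluating at `a`.
Thus f and f(a·) span a space stable under y ↦ xy, and `indexTwoRep` is the matrix of this action,
with f as its (0, 1) entry. -/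
theorem map_mul_of_ker_closed (f : R →+ ZMod 2) (hf : ∀ x y, f x = 0 → f y = 0 → f (x * y) = 0)
    {a : R} (ha : f a = 1) (x y : R) :
    f (x * y) = (f (x * a) + f x * f (a * a)) * f y + f x * f (a * y) := by
  have key (s y : R) (hs : f s = 0) : f (s * y) = f (s * a) * f y := by
    rcases ZMod.two_cases (f y) with h | h
    · rw [hf s y hs h, h, mul_zero]
    · have := hf s (y - a) hs (by rw [map_sub, h, ha, sub_self])
      rw [mul_sub, map_sub, sub_eq_zero] at this
      rw [this, h, mul_one]
  rcases ZMod.two_cases (f x) with h | h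
  · rw [key x y h, h]
    ring
  · have := key (x - a) y (by rw [map_sub, h, ha, sub_self])
    rw [sub_mul, sub_mul, map_sub, map_sub] at this
    rw [h]
    have h2 : (2 : ZMod 2) = 0 := rfl
    linear_combination this - f (a * a) * f y * h2

/-- The `2`-dimensional representation attached to a unital subring of index `2`. -/
def indexTwoRep (f : R →+ ZMod 2) (hf : ∀ x y, f x = 0 → f y = 0 → f (x * y) = 0)
    (h1 : f 1 = 0) {a : R} (ha : f a = 1) : R →+* Matrix (Fin 2) (Fin 2) (ZMod 2) where
  toFun x := !![f (x * a) + f x * f (a * a), f x;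
    f (a * x * a) + f (a * x) * f (a * a), f (a * x)]
  map_one' := by
    rw [one_mul, mul_one, h1, ha, Matrix.one_fin_two, zero_mul, add_zero, one_mul,
      CharTwo.add_self_eq_zero]
  map_zero' := by
    ext i j
    fin_cases i <;> fin_cases j <;> simp
  map_add' x y := by
    ext i j
    fin_cases i <;> fin_cases j <;> simp [add_mul, mul_add] <;> ring
  map_mul' x y := by
    have m := map_mul_of_ker_closed f hf ha
    ext i j
    fin_cases i <;> fin_cases j <;>
      simp only [Fin.zero_eta, Fin.mk_one, Matrix.of_apply, Matrix.cons_val', Matrix.cons_val_zero,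
        Matrix.cons_val_one, Matrix.cons_val_fin_one, Matrix.mul_apply, Fin.sum_univ_two,
        Fin.isValue]
    · rw [mul_assoc x y a, m x (y * a), m x y, ← mul_assoc a y a]
      ring
    · rw [m x y]
    · rw [← mul_assoc a x y, mul_assoc (a * x) y a, m (a * x) (y * a), m (a * x) y,
        ← mul_assoc a y a]
      ring
    · rw [← mul_assoc a x y, m (a * x) y]

/-- The possible kinds of unital subrings of index `2`. -/
theorem index_two_cases (f : R →+ ZMod 2) (hf : ∀ x y, f x = 0 → f y = 0 → f (x * y) = 0)
    (h1 : f 1 = 0) (hf0 : ∃ x, f x ≠ 0) :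
    HasThreeCover R ∨ HasQuotientIso R (Matrix (Fin 2) (Fin 2) (ZMod 2)) ∨
      (∃ χ : R →+* ZMod 2, ∀ x y, f (x * y) = χ x * f y + f x * χ y) ∨
      ∃ (φ : R →+* GaloisField 2 2) (w : GaloisField 2 2) (u : R → ZMod 2), w ^ 2 + w + 1 = 0 ∧
        ∀ x, φ x = algebraMap (ZMod 2) _ (u x) + algebraMap (ZMod 2) _ (f x) * w := by
  obtain ⟨a, ha⟩ := hf0
  replace ha := (ZMod.two_cases (f a)).resolve_left ha
  set M := indexTwoRep f hf h1 ha with hMdef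
  have hM01 (x) : M x 0 1 = f x := rfl
  have h2 : (2 : ZMod 2) = 0 := rfl
  have mul (x y i j) : M (x * y) i j = M x i 0 * M y 0 j + M x i 1 * M y 1 j := by
    rw [map_mul, Matrix.mul_apply, Fin.sum_univ_two]
  have add (x y i j) : M (x + y) i j = M x i j + M y i j := by
    rw [map_add, Matrix.add_apply]
  have zero (i j) : M 0 i j = 0 := by rw [map_zero, Matrix.zero_apply]
  have one (i) : M 1 i i = 1 := by rw [map_one, Matrix.one_apply_eq]
  have hder (χ ψ : R →+* ZMod 2) (h : ∀ x y, f (x * y) = χ x * f y + f x * ψ y) :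
      HasThreeCover R ∨ HasQuotientIso R (Matrix (Fin 2) (Fin 2) (ZMod 2)) ∨
      (∃ χ : R →+* ZMod 2, ∀ x y, f (x * y) = χ x * f y + f x * χ y) ∨
      ∃ (φ : R →+* GaloisField 2 2) (w : GaloisField 2 2) (u : R → ZMod 2), w ^ 2 + w + 1 = 0 ∧
        ∀ x, φ x = algebraMap (ZMod 2) _ (u x) + algebraMap (ZMod 2) _ (f x) * w := by
    by_cases hχ : χ = ψ
    · subst hχ
      exact Or.inr (Or.inr (Or.inl ⟨χ, h⟩))
    · exact Or.inl (hasThreeCover_of_ringHom_ne χ ψ hχ)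
  by_cases hs : Function.Surjective M
  · exact Or.inr (Or.inl (hasQuotientIso_of_surjective M hs))
  rcases matrix_hom_cases M a ((hM01 a).trans ha) hs with h | h | h
  · let χ : R →+* ZMod 2 :=
      { toFun := fun x => M x 0 0
        map_one' := one 0
        map_zero' := zero 0 0
        map_add' := fun x y => add x y 0 0
        map_mul' := fun x y => by rw [mul, h y]; ring }
    let ψ : R →+* ZMod 2 :=
      { toFun := fun x => M x 1 1
        map_one' := one 1
        map_zero' := zero 1 1
        map_add' := fun x y => add x y 1 1
        map_mul' := fun x y => by rw [mul, h x]; ring }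
    exact hder χ ψ fun x y => mul x y 0 1
  -- The vector (1, 1) is a common eigenvector: χ is its eigenvalue and ψ the one on the quotient
  -- line.
  · let χ : R →+* ZMod 2 :=
      { toFun := fun x => M x 0 0 + M x 0 1
        map_one' := by rw [one, hM01, h1, add_zero]
        map_zero' := by rw [zero, zero, add_zero]
        map_add' := fun x y => by rw [add, add]; ring
        map_mul' := fun x y => by rw [mul, mul]; linear_combination - M x 0 1 * h y }
    let ψ : R →+* ZMod 2 :=
      { toFun := fun x => M x 1 1 - M x 0 1
        map_one' := by rw [one, hM01, h1, sub_zero]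
        map_zero' := by rw [zero, zero, sub_zero]
        map_add' := fun x y => by rw [add, add]; ring
        map_mul' := fun x y => by rw [mul, mul]; linear_combination - M y 0 1 * h x }
    refine hder χ ψ fun x y => ?_
    change _ = (M x 0 0 + M x 0 1) * M y 0 1 + M x 0 1 * (M y 1 1 - M y 0 1)
    rw [← hM01, mul]
    ring
  · obtain ⟨w, hw⟩ := GaloisField.exists_root_four
    refine Or.inr (Or.inr (Or.inr ⟨
      { toFun := fun x => algebraMap (ZMod 2) _ (M x 0 0) + algebraMap (ZMod 2) _ (M x 0 1) * w
        map_one' := by rw [one, hM01, h1, map_one, map_zero, zero_mul, add_zero]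
        map_zero' := by rw [zero, zero, map_zero, zero_mul, add_zero]
        map_add' := fun x y => by rw [add, add, map_add, map_add]; ring
        map_mul' := fun x y => ?_ }, w, fun x => M x 0 0, hw, fun x => rfl⟩))
    have h2' : (2 : GaloisField 2 2) = 0 := CharTwo.two_eq_zero
    rw [mul, mul, (h y).1, (h y).2]
    simp only [map_add, map_mul]
    linear_combination (-algebraMap (ZMod 2) (GaloisField 2 2) (M x 0 1) *
      algebraMap (ZMod 2) (GaloisField 2 2) (M y 0 1)) * (hw - (1 + w) * h2')

end IndexTwo

/-! ### Four lines of subrings over F₃, and the multiplication tables. -/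

section IndexThree

variable {R : Type*} [Ring R]

/-- Two additive functionals whose four lines of combinations have kernels closed under
multiplication, together with a dual pair of elements. -/
structure SubringPencil (α β : R →+ ZMod 3) (a b : R) : Prop where
  fst_left : α a = 1
  snd_left : β a = 0
  fst_right : α b = 0
  snd_right : β b = 1
  fst_mul : ∀ x y, α x = 0 → α y = 0 → α (x * y) = 0
  snd_mul : ∀ x y, β x = 0 → β y = 0 → β (x * y) = 0
  diag_mul : ∀ x y, α x = β x → α y = β y → α (x * y) = β (x * y)
  antidiag_mul : ∀ x y, α x = -β x → α y = -β y → α (x * y) = -β (x * y)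

theorem ZMod.three_lines : ∀ p q : ZMod 3, p = 0 ∨ q = 0 ∨ p = q ∨ p = -q := by decide

namespace SubringPencil

variable {α β : R →+ ZMod 3} {a b : R}

theorem exists_decomp (h : SubringPencil α β a b) (x : R) :
    ∃ (m n : ℕ) (d : R), α d = 0 ∧ β d = 0 ∧ (m : ZMod 3) = α x ∧ (n : ZMod 3) = β x ∧
      x = m • a + n • b + d := by
  refine ⟨(α x).val, (β x).val, x - (α x).val • a - (β x).val • b, ?_, ?_, ?_, ?_, by abel⟩
  · simp only [map_sub, map_nsmul, h.fst_left, h.fst_right]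
    simp
  · simp only [map_sub, map_nsmul, h.snd_left, h.snd_right]
    simp
  · simp
  · simp

/-- Multiplication by `d` preserves both axes and the diagonal of the plane R/D, where D = ker α ∩
ker β, hence acts on it as a scalar, read off at `a`. -/
theorem left_scalar (h : SubringPencil α β a b) {d : R} (h1 : α d = 0) (h2 : β d = 0) (x : R) :
    α (d * x) = α (d * a) * α x ∧ β (d * x) = α (d * a) * β x := by
  obtain ⟨m, n, d', h3, h4, hm, hn, hx⟩ := h.exists_decomp x
  have e1 : α (d * b) = 0 := h.fst_mul _ _ h1 h.fst_right
  have e2 : β (d * a) = 0 := h.snd_mul _ _ h2 h.snd_left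
  have e3 : α (d * a) = β (d * b) := by
    have := h.diag_mul d (a + b) (by rw [h1, h2]) (by
      rw [map_add, map_add, h.fst_left, h.snd_left, h.fst_right, h.snd_right]; rfl)
    rwa [mul_add, map_add, map_add, e1, e2, add_zero, zero_add] at this
  have e4 := h.fst_mul _ _ h1 h3
  have e5 := h.snd_mul _ _ h2 h4
  rw [← hm, ← hn]
  subst hx
  simp only [mul_add, map_add, mul_smul_comm, map_nsmul, e1, e2, e4, e5, ← e3]
  simp only [nsmul_eq_mul]
  constructor <;> ring

theorem right_scalar (h : SubringPencil α β a b) {d : R} (h1 : α d = 0) (h2 : β d = 0) (x : R) :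
    α (x * d) = α (a * d) * α x ∧ β (x * d) = α (a * d) * β x := by
  obtain ⟨m, n, d', h3, h4, hm, hn, hx⟩ := h.exists_decomp x
  have e1 : α (b * d) = 0 := h.fst_mul _ _ h.fst_right h1
  have e2 : β (a * d) = 0 := h.snd_mul _ _ h.snd_left h2
  have e3 : α (a * d) = β (b * d) := by
    have := h.diag_mul (a + b) d (by
      rw [map_add, map_add, h.fst_left, h.snd_left, h.fst_right, h.snd_right]; rfl)
      (by rw [h1, h2])
    rwa [add_mul, map_add, map_add, e1, e2, add_zero, zero_add] at this
  have e4 := h.fst_mul _ _ h3 h1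
  have e5 := h.snd_mul _ _ h4 h2
  rw [← hm, ← hn]
  subst hx
  simp only [add_mul, map_add, smul_mul_assoc, map_nsmul, e1, e2, e4, e5, ← e3]
  simp only [nsmul_eq_mul]
  constructor <;> ring

/-- Modulo D, every `x` lies on one of the four lines, and its square lies on the same line. -/
theorem sq_mem_line (h : SubringPencil α β a b) (x : R) : α x * β (x * x) = β x * α (x * x) := by
  rcases ZMod.three_lines (α x) (β x) with e | e | e | e
  · rw [e, h.fst_mul x x e e]; ring
  · rw [e, h.snd_mul x x e e]; ring
  · rw [e, h.diag_mul x x e e]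
  · rw [e, h.antidiag_mul x x e e]; ring

theorem one_mem_kernels (h : SubringPencil α β a b) : α 1 = 0 ∧ β 1 = 0 := by
  have key (y : R) : α 1 * β y = β 1 * α y := by
    have e0 := h.sq_mem_line y
    -- The difference of the identities at 1 + y and 1 − y isolates the terms odd in `y`.
    have e1 := h.sq_mem_line (1 + y)
    have e2 := h.sq_mem_line (1 - y)
    simp only [mul_add, add_mul, mul_sub, sub_mul, mul_one, one_mul, map_add, map_sub] at e1 e2
    have h3 : (3 : ZMod 3) = 0 := rfl
    linear_combination 2 * e1 - 2 * e2 - 4 * e0 - (α 1 * β y - β 1 * α y) * h3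
  have ka := key a
  have kb := key b
  rw [h.snd_left, h.fst_left] at ka
  rw [h.snd_right, h.fst_right] at kb
  exact ⟨by linear_combination kb, by linear_combination -ka⟩

/-- With `kernel_mul`, this makes the elements of D acting by zero on both sides of R/D a two-sided
ideal. -/
theorem mul_kernel (h : SubringPencil α β a b) {k : R} (h1 : α k = 0) (h2 : β k = 0) (h3 : α (k * a) = 0)
    (h4 : α (a * k) = 0) (x : R) :
    α (x * k) = 0 ∧ β (x * k) = 0 ∧ α (x * k * a) = 0 ∧ α (a * (x * k)) = 0 := by
  have r := h.right_scalar h1 h2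
  have l := h.left_scalar h1 h2
  rw [h4] at r
  rw [h3] at l
  have e1 (x) : α (x * k) = 0 := by rw [(r x).1, zero_mul]
  have e2 (x) : β (x * k) = 0 := by rw [(r x).2, zero_mul]
  have f1 (x) : α (k * x) = 0 := by rw [(l x).1, zero_mul]
  have f2 (x) : β (k * x) = 0 := by rw [(l x).2, zero_mul]
  refine ⟨e1 x, e2 x, ?_, by rw [← mul_assoc, e1]⟩
  obtain ⟨m, n, d, hd1, hd2, -, -, hx⟩ := h.exists_decomp x
  -- The left scalar of ak can be read at `b` instead of `a`; reassociating (ak)b = a(kb), the right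
  -- scalar of kb multiplies β(a) = 0.
  have g1 : α (a * k * a) = 0 := by
    have i1 := (h.left_scalar (e1 a) (e2 a) b).2
    have i2 := (h.right_scalar (f1 b) (f2 b) a).2
    rw [← mul_assoc, h.snd_left, mul_zero] at i2
    rw [h.snd_right, mul_one, i2] at i1
    exact i1.symm
  have g2 : α (b * k * a) = 0 := by
    have i2 := (h.right_scalar (f1 a) (f2 a) b).1
    rwa [h.fst_right, mul_zero, ← mul_assoc] at i2
  have g3 : α (d * k * a) = 0 := by
    rw [mul_assoc, (h.left_scalar hd1 hd2 _).1, h3, mul_zero]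
  rw [hx]
  simp only [add_mul, smul_mul_assoc, map_add, map_nsmul, g1, g2, g3, smul_zero, add_zero]

theorem kernel_mul (h : SubringPencil α β a b) {k : R} (h1 : α k = 0) (h2 : β k = 0) (h3 : α (k * a) = 0)
    (h4 : α (a * k) = 0) (x : R) :
    α (k * x) = 0 ∧ β (k * x) = 0 ∧ α (k * x * a) = 0 ∧ α (a * (k * x)) = 0 := by
  have r := h.right_scalar h1 h2
  have l := h.left_scalar h1 h2
  rw [h4] at r
  rw [h3] at l
  have e1 (x) : α (x * k) = 0 := by rw [(r x).1, zero_mul]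
  have e2 (x) : β (x * k) = 0 := by rw [(r x).2, zero_mul]
  have f1 (x) : α (k * x) = 0 := by rw [(l x).1, zero_mul]
  have f2 (x) : β (k * x) = 0 := by rw [(l x).2, zero_mul]
  refine ⟨f1 x, f2 x, by rw [mul_assoc, f1], ?_⟩
  obtain ⟨m, n, d, hd1, hd2, -, -, hx⟩ := h.exists_decomp x
  have g1 : α (a * (k * a)) = 0 := by
    have i1 := (h.right_scalar (f1 a) (f2 a) b).2
    have i2 := (h.left_scalar (e1 b) (e2 b) a).2
    rw [mul_assoc, h.snd_left, mul_zero] at i2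
    rw [h.snd_right, mul_one, i2] at i1
    exact i1.symm
  have g2 : α (a * (k * b)) = 0 := by
    have i2 := (h.left_scalar (e1 a) (e2 a) b).1
    rwa [h.fst_right, mul_zero, mul_assoc] at i2
  have g3 : α (a * (k * d)) = 0 := by
    rw [← mul_assoc, (h.right_scalar hd1 hd2 _).1, e1, mul_zero]
  rw [hx]
  simp only [mul_add, mul_smul_comm, map_add, map_nsmul, g1, g2, g3, smul_zero, add_zero]

end SubringPencil

/-- The upper triangular matrix with rows `(p, q)` and `(0, r)`. -/
def upperTriangularMk {F : Type*} [CommRing F] (p q r : F) : UpperTriangularTwo F :=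
  ⟨!![p, q; 0, r], by intro i j hij; fin_cases i <;> fin_cases j <;> simp_all⟩

theorem upperTriangular_ext {F : Type*} [CommRing F] {x y : UpperTriangularTwo F}
    (h00 : x.1 0 0 = y.1 0 0) (h01 : x.1 0 1 = y.1 0 1) (h11 : x.1 1 1 = y.1 1 1) : x = y := by
  refine Subtype.ext (Matrix.ext fun i j => ?_)
  have hx : x.1 1 0 = 0 := x.2 (by simp)
  have hy : y.1 1 0 = 0 := y.2 (by simp)
  fin_cases i <;> fin_cases j <;> simp_all

theorem upperTriangularMk_mul {F : Type*} [CommRing F] (p q r p' q' r' : F) :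
    upperTriangularMk p q r * upperTriangularMk p' q' r' =
      upperTriangularMk (p * p') (p * q' + q * r') (r * r') := by
  apply upperTriangular_ext <;> simp [upperTriangularMk, Matrix.mul_apply]

theorem upperTriangularMk_add {F : Type*} [CommRing F] (p q r p' q' r' : F) :
    upperTriangularMk p q r + upperTriangularMk p' q' r' =
      upperTriangularMk (p + p') (q + q') (r + r') := by
  apply upperTriangular_ext <;> simp [upperTriangularMk]

theorem upperTriangularMk_neg {F : Type*} [CommRing F] (p q r : F) :
    -upperTriangularMk p q r = upperTriangularMk (-p) (-q) (-r) := by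
  apply upperTriangular_ext <;> simp [upperTriangularMk]

theorem upperTriangularMk_smul {F : Type*} [CommRing F] (c p q r : F) :
    c • upperTriangularMk p q r = upperTriangularMk (c * p) (c * q) (c * r) := by
  apply upperTriangular_ext <;> simp [upperTriangularMk]

theorem upperTriangularMk_one {F : Type*} [CommRing F] :
    upperTriangularMk (1 : F) 0 1 = 1 := by
  apply upperTriangular_ext <;> simp [upperTriangularMk]

theorem upperTriangularMk_zero {F : Type*} [CommRing F] :
    upperTriangularMk (0 : F) 0 0 = 0 := by
  apply upperTriangular_ext <;> simp [upperTriangularMk]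

theorem upperTriangular_eq_mk {F : Type*} [CommRing F] (x : UpperTriangularTwo F) :
    x = upperTriangularMk (x.1 0 0) (x.1 0 1) (x.1 1 1) := by
  apply upperTriangular_ext <;> simp [upperTriangularMk]

/-- Multiplication table of a three-dimensional algebra spanned by `1, a, b`. -/
structure ThreeDimTable {F A : Type*} [CommRing F] [Ring A] [Algebra F A] (u t : F) (a b : A) :
    Prop where
  left_sq : a * a = (u * u) • (1 : A)
  right_sq : b * b = (t * t) • (1 : A)
  left_right : a * b = (-(u * t)) • (1 : A) + t • a + u • b
  right_left : b * a = (-(u * t)) • (1 : A) - t • a - u • b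

theorem ThreeDimTable.mul_eq {F A : Type*} [CommRing F] [Ring A] [Algebra F A] {u t : F} {a b : A}
    (h : ThreeDimTable u t a b) (c x y c' x' y' : F) :
    (c • (1 : A) + x • a + y • b) * (c' • (1 : A) + x' • a + y' • b) =
      (c * c' + x * x' * (u * u) + y * y' * (t * t) - (x * y' + y * x') * (u * t)) • (1 : A) +
      (c * x' + x * c' + (x * y' - y * x') * t) • a +
      (c * y' + y * c' + (x * y' - y * x') * u) • b := by
  simp only [mul_add, add_mul, smul_mul_smul_comm, one_mul, mul_one, h.left_sq, h.right_sq,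
    h.left_right, h.right_left]
  module

theorem ThreeDimTable.upperTriangular {F : Type*} [CommRing F] (u t : F) :
    ThreeDimTable u t (upperTriangularMk u t (-u)) (upperTriangularMk (-t) u t) := by
  constructor <;>
  simp only [← upperTriangularMk_one, sub_eq_add_neg, upperTriangularMk_mul,
    upperTriangularMk_smul, upperTriangularMk_neg, upperTriangularMk_add] <;>
  congr 1 <;> ring

theorem ThreeDimTable.truncated {F : Type*} [CommRing F] :
    ThreeDimTable (0 : F) 0
      (Ideal.Quotient.mk _ (MvPolynomial.X 0) : TruncatedPolynomialTwo F)
      (Ideal.Quotient.mk _ (MvPolynomial.X 1)) := by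
  constructor <;> simp only [zero_mul, neg_zero, zero_smul, add_zero, sub_zero, ← map_mul] <;>
    rw [Ideal.Quotient.eq_zero_iff_mem] <;> apply Ideal.subset_span
  · simp [pow_two]
  · simp [pow_two]
  · simp
  · simp [mul_comm]

/-- A surjective homomorphism out of an algebra with basis `1, a, b` is determined by elements
satisfying the same multiplication table. -/
theorem ThreeDimTable.exists_ringHom {F A B : Type*} [CommRing F] [Ring A] [Algebra F A] [Ring B]
    [Algebra F B] {u t : F} {a b : A} {a' b' : B} (hA : ThreeDimTable u t a b)
    (hB : ThreeDimTable u t a' b')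
    (hind : ∀ c x y c' x' y' : F, c • (1 : A) + x • a + y • b = c' • (1 : A) + x' • a + y' • b →
      c = c' ∧ x = x' ∧ y = y')
    (hspan : ∀ r : A, ∃ c x y : F, r = c • (1 : A) + x • a + y • b) :
    ∃ θ : A →+* B, ∀ c x y : F,
      θ (c • (1 : A) + x • a + y • b) = c • (1 : B) + x • a' + y • b' := by
  choose C X Y hr using hspan
  have hC (c x y : F) : C (c • (1 : A) + x • a + y • b) = c ∧
      X (c • (1 : A) + x • a + y • b) = x ∧ Y (c • (1 : A) + x • a + y • b) = y :=
    hind _ _ _ _ _ _ (hr _).symm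
  have hθ (c x y : F) : (fun r => C r • (1 : B) + X r • a' + Y r • b')
      (c • (1 : A) + x • a + y • b) = c • (1 : B) + x • a' + y • b' := by
    obtain ⟨h1, h2, h3⟩ := hC c x y
    simp only [h1, h2, h3]
  refine ⟨
    { toFun := fun r => C r • (1 : B) + X r • a' + Y r • b'
      map_one' := ?_
      map_zero' := ?_
      map_add' := fun r s => ?_
      map_mul' := fun r s => ?_ }, hθ⟩
  · have := hθ 1 0 0
    simpa using this
  · rw [hB.mul_eq]
    refine Eq.trans ?_ (hθ _ _ _)
    rw [← hA.mul_eq, ← hr r, ← hr s]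
  · have := hθ 0 0 0
    simpa using this
  · have := hθ (C r + C s) (X r + X s) (Y r + Y s)
    have e : (C r + C s) • (1 : A) + (X r + X s) • a + (Y r + Y s) • b = r + s := by
      conv_rhs => rw [hr r, hr s]
      module
    rw [e] at this
    refine this.trans ?_
    module

end IndexThree

/-! ### The case where only 0 in D acts by zero on both sides. -/

section ReducedPencil

variable {R : Type*} [Ring R] [Algebra (ZMod 3) R] {α β : R →+ ZMod 3} {a b : R}

theorem SubringPencil.hasQuotientIso_of_ne (h : SubringPencil α β a b)
    (hred : ∀ d, α d = 0 → β d = 0 → α (d * a) = 0 → α (a * d) = 0 → d = 0)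
    {d : R} (hd1 : α d = 0) (hd2 : β d = 0) (hd : α (d * a) ≠ α (a * d)) :
    HasQuotientIso R (UpperTriangularTwo (ZMod 3)) := by
  have sα (c : ZMod 3) (x : R) : α (c • x) = c * α x := ZMod.map_smul α c x
  have sβ (c : ZMod 3) (x : R) : β (c • x) = c * β x := ZMod.map_smul β c x
  obtain ⟨α1, β1⟩ := h.one_mem_kernels
  have l {d : R} (h1 : α d = 0) (h2 : β d = 0) (x : R) := (h.left_scalar h1 h2 x).1
  have r {d : R} (h1 : α d = 0) (h2 : β d = 0) (x : R) := (h.right_scalar h1 h2 x).1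
  -- Both scalars of 1 are 1, so subtracting a multiple of 1 and rescaling gives left scalar 1 and
  -- right scalar 0; then e² − e has both scalars 0, and `hred` makes `e` idempotent.
  obtain ⟨e, e1, e2, e3, e4⟩ : ∃ e, α e = 0 ∧ β e = 0 ∧ α (e * a) = 1 ∧ α (a * e) = 0 := by
    refine ⟨(α (d * a) - α (a * d))⁻¹ • (d - α (a * d) • (1 : R)), ?_, ?_, ?_, ?_⟩
    · rw [sα, map_sub, sα, hd1, α1]; ring
    · rw [sβ, map_sub, sβ, hd2, β1]; ring
    · rw [smul_mul_assoc, sub_mul, smul_mul_assoc, one_mul, sα, map_sub, sα, h.fst_left, mul_one]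
      exact inv_mul_cancel₀ (sub_ne_zero.2 hd)
    · rw [mul_smul_comm, mul_sub, mul_smul_comm, mul_one, sα, map_sub, sα, h.fst_left]; ring
  have hidem : e * e = e := by
    have q1 : α (e * e * a) = 1 := by rw [mul_assoc, l e1 e2, e3, mul_one]
    have q2 : α (a * (e * e)) = 0 := by rw [← mul_assoc, r e1 e2, e4, zero_mul]
    refine sub_eq_zero.1 (hred _ ?_ ?_ ?_ ?_)
    · rw [map_sub, h.fst_mul _ _ e1 e1, e1, sub_zero]
    · rw [map_sub, h.snd_mul _ _ e2 e2, e2, sub_zero]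
    · rw [sub_mul, map_sub, q1, e3, sub_self]
    · rw [mul_sub, map_sub, q2, e4, sub_self]
  obtain ⟨f, hf⟩ : ∃ f, f = 1 - e := ⟨_, rfl⟩
  have hef : e * f = 0 := by rw [hf, mul_sub, hidem, mul_one, sub_self]
  have hfe : f * e = 0 := by rw [hf, sub_mul, hidem, one_mul, sub_self]
  have hff : f * f = f := by rw [hf, mul_sub, ← hf, hfe, mul_one, sub_zero]
  have hone : e + f = 1 := by rw [hf]; abel
  have f1 : α f = 0 := by rw [hf, map_sub, α1, e1, sub_zero]
  have f2 : β f = 0 := by rw [hf, map_sub, β1, e2, sub_zero]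
  have f3 : α (f * a) = 0 := by rw [hf, sub_mul, one_mul, map_sub, h.fst_left, e3, sub_self]
  have f4 : α (a * f) = 1 := by rw [hf, mul_sub, mul_one, map_sub, h.fst_left, e4, sub_zero]
  have le (x) : α (e * x) = α x := by rw [l e1 e2, e3, one_mul]
  have re (x) : α (x * e) = 0 := by rw [r e1 e2, e4, zero_mul]
  have lf (x) : α (f * x) = 0 := by rw [l f1 f2, f3, zero_mul]
  have rf (x) : α (x * f) = α x := by rw [r f1 f2, f4, one_mul]
  have reβ (x) : β (x * e) = 0 := by rw [(h.right_scalar e1 e2 x).2, e4, zero_mul]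
  have lfβ (x) : β (f * x) = 0 := by rw [(h.left_scalar f1 f2 x).2, f3, zero_mul]
  -- Elements of fRe lie in D and act by zero on both sides, so the Peirce decomposition is
  -- triangular.
  have hfse (s) : f * s * e = 0 := by
    refine hred _ (re _) (reβ _) ?_ ?_
    · rw [mul_assoc, mul_assoc, lf]
    · rw [← mul_assoc, re]
  have hL (x s : R) : e * (x * s) * e = e * x * e * (e * s * e) := by
    calc e * (x * s) * e = e * x * (e + f) * s * e := by rw [hone, mul_one]; noncomm_ring
      _ = e * x * e * s * e + e * x * (f * s * e) := by noncomm_ring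
      _ = e * x * (e * e) * s * e := by rw [hfse, mul_zero, add_zero, hidem]
      _ = _ := by noncomm_ring
  have hP (x s : R) : f * (x * s) * f = f * x * f * (f * s * f) := by
    calc f * (x * s) * f = f * x * (e + f) * s * f := by rw [hone, mul_one]; noncomm_ring
      _ = (f * x * e) * s * f + f * x * f * s * f := by noncomm_ring
      _ = f * x * (f * f) * s * f := by rw [hfse, zero_mul, zero_mul, zero_add, hff]
      _ = _ := by noncomm_ring
  -- The diagonal entries are the left scalar of exe and the right scalar of fxf; the corner is α(x)
  -- = α(exf).
  let θ : R →+* UpperTriangularTwo (ZMod 3) :=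
    { toFun := fun x => upperTriangularMk (α (e * x * e * a)) (α x) (α (a * (f * x * f)))
      map_one' := by
        rw [mul_one, mul_one, hidem, hff, e3, f4, α1, upperTriangularMk_one]
      map_zero' := by simp [upperTriangularMk_zero]
      map_add' := fun x y => by
        rw [upperTriangularMk_add]
        simp only [mul_add, add_mul, map_add]
      map_mul' := fun x s => by
        rw [upperTriangularMk_mul, hL, hP]
        congr 1
        · rw [mul_assoc, l (re _) (reβ _)]
        · have : x * s = e * x * e * s + x * (f * s) - (f * x * e) * s := by
            calc x * s = (e + f) * x * (e + f) * s - f * x * f * s + f * x * f * s := by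
                  rw [hone]; noncomm_ring
              _ = e * x * e * s + (e + f) * x * (f * s) + (f * x * e) * s := by noncomm_ring
              _ = _ := by rw [hone, hfse]; noncomm_ring
          have hs : α (x * (f * s)) = α (x * (f * s * f)) := by
            rw [← mul_assoc x (f * s) f, rf]
          rw [this, hfse, zero_mul, sub_zero, map_add, l (re _) (reβ _), hs,
            r (rf _ |>.trans (lf _)) (by rw [mul_assoc]; exact lfβ _), mul_comm (α x)]
        · rw [← mul_assoc a, r (rf _ |>.trans (lf _)) (by rw [mul_assoc]; exact lfβ _),
            mul_comm] }
  refine hasQuotientIso_of_surjective θ fun m => ?_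
  obtain ⟨p, q, s, rfl⟩ : ∃ p q s, m = upperTriangularMk p q s := ⟨_, _, _, upperTriangular_eq_mk m⟩
  refine ⟨p • e + s • f + q • (e * a * f), ?_⟩
  change upperTriangularMk _ _ _ = _
  have q1 : e * (p • e + s • f + q • (e * a * f)) * e = p • e := by
    simp only [mul_add, add_mul, mul_smul_comm, smul_mul_assoc, hidem, hef, smul_zero,
      add_zero]
    rw [mul_assoc, mul_assoc _ f e, hfe]
    simp
  have q2 : f * (p • e + s • f + q • (e * a * f)) * f = s • f := by
    simp only [mul_add, add_mul, mul_smul_comm, smul_mul_assoc, hff, hfe, smul_zero,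
      zero_add]
    rw [← mul_assoc, ← mul_assoc, hfe]
    simp
  have q3 : α (p • e + s • f + q • (e * a * f)) = q := by
    rw [map_add, map_add, sα, sα, sα, e1, f1, rf, le, h.fst_left]
    ring
  rw [q1, q2, q3, smul_mul_assoc, mul_smul_comm, sα, sα, e3, f4, mul_one, mul_one]

theorem SubringPencil.hasQuotientIso_of_forall_eq (h : SubringPencil α β a b)
    (hred : ∀ d, α d = 0 → β d = 0 → α (d * a) = 0 → α (a * d) = 0 → d = 0)
    (heq : ∀ d, α d = 0 → β d = 0 → α (d * a) = α (a * d)) :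
    HasQuotientIso R (TruncatedPolynomialTwo (ZMod 3)) ∨
      HasQuotientIso R (UpperTriangularTwo (ZMod 3)) := by
  have h3 : (3 : ZMod 3) = 0 := rfl
  have sα (c : ZMod 3) (x : R) : α (c • x) = c * α x := ZMod.map_smul α c x
  have sβ (c : ZMod 3) (x : R) : β (c • x) = c * β x := ZMod.map_smul β c x
  obtain ⟨α1, β1⟩ := h.one_mem_kernels
  -- Equal left and right scalars let a multiple of 1 cancel both, so D consists of scalars.
  have hD (d) (h1 : α d = 0) (h2 : β d = 0) : ∃ c : ZMod 3, d = c • (1 : R) := by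
    refine ⟨α (d * a), sub_eq_zero.1 (hred _ ?_ ?_ ?_ ?_)⟩
    · rw [map_sub, sα, h1, α1]; ring
    · rw [map_sub, sβ, h2, β1]; ring
    · rw [sub_mul, smul_mul_assoc, one_mul, map_sub, sα, h.fst_left]; ring
    · rw [mul_sub, mul_smul_comm, mul_one, map_sub, sα, h.fst_left, ← heq d h1 h2]; ring
  clear hred heq
  obtain ⟨a, b, h, αaa, βbb⟩ : ∃ a b, SubringPencil α β a b ∧ α (a * a) = 0 ∧ β (b * b) = 0 := by
    -- Adding c·1 to `a` changes α(a²) by 2c, so c = α(a²) makes it vanish in characteristic 3.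
    refine ⟨a + α (a * a) • (1 : R), b + β (b * b) • (1 : R),
      { h with
        fst_left := by rw [map_add, sα, h.fst_left, α1]; ring
        snd_left := by rw [map_add, sβ, h.snd_left, β1]; ring
        fst_right := by rw [map_add, sα, h.fst_right, α1]; ring
        snd_right := by rw [map_add, sβ, h.snd_right, β1]; ring }, ?_, ?_⟩
    · simp only [mul_add, add_mul, smul_mul_assoc, mul_smul_comm, one_mul, mul_one, map_add, sα,
        h.fst_left, α1]
      linear_combination α (a * a) * h3
    · simp only [mul_add, add_mul, smul_mul_assoc, mul_smul_comm, one_mul, mul_one, map_add, sβ,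
        h.snd_right, β1]
      linear_combination β (b * b) * h3
  obtain ⟨αa, βa, αb, βb⟩ : α a = 1 ∧ β a = 0 ∧ α b = 0 ∧ β b = 1 :=
    ⟨h.fst_left, h.snd_left, h.fst_right, h.snd_right⟩
  obtain ⟨v, hv⟩ := hD _ αaa (h.snd_mul _ _ βa βa)
  obtain ⟨w, hw⟩ := hD _ (h.fst_mul _ _ αb αb) βbb
  obtain ⟨t, ht⟩ : ∃ t, α (a * b) = t := ⟨_, rfl⟩
  obtain ⟨u, hu⟩ : ∃ u, β (a * b) = u := ⟨_, rfl⟩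
  -- Comparing squares of a + b and a − b puts ab + ba in D.
  have hsum : α (b * a) = -t ∧ β (b * a) = -u := by
    have i1 := h.sq_mem_line (a + b)
    have i2 := h.sq_mem_line (a - b)
    simp only [mul_add, add_mul, mul_sub, sub_mul, map_add, map_sub, hv, hw, sα, sβ, α1, β1, αa,
      αb, βa, βb, ht, hu] at i1 i2
    constructor
    · linear_combination i1 + i2 + (t + α (b * a)) * h3
    · linear_combination i2 - i1 + (u + β (b * a)) * h3
  obtain ⟨αba, βba⟩ := hsum
  obtain ⟨s, hs⟩ := hD (a * b - t • a - u • b)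
    (by simp only [map_sub, sα, αa, αb, ht]; ring) (by simp only [map_sub, sβ, βa, βb, hu]; ring)
  obtain ⟨s', hs'⟩ := hD (b * a + t • a + u • b)
    (by simp only [map_add, sα, αa, αb, αba]; ring) (by simp only [map_add, sβ, βa, βb, βba]; ring)
  have hab : a * b = s • (1 : R) + t • a + u • b := by rw [← hs]; abel
  have hba : b * a = s' • (1 : R) - t • a - u • b := by rw [← hs']; abel
  -- Associativity of a·a·b and b·b·a expresses the four remaining constants through `u` and `t`.
  have as1 : v • b = s • a + t • (v • (1 : R)) + u • (a * b) := by
    calc v • b = a * a * b := by rw [hv, smul_mul_assoc, one_mul]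
      _ = a * (a * b) := mul_assoc _ _ _
      _ = _ := by
        conv_lhs => rw [hab]
        simp only [mul_add, mul_smul_comm, mul_one, hv]
  have as2 : w • a = s' • b - t • (b * a) - u • (w • (1 : R)) := by
    calc w • a = b * b * a := by rw [hw, smul_mul_assoc, one_mul]
      _ = b * (b * a) := mul_assoc _ _ _
      _ = _ := by
        conv_lhs => rw [hba]
        simp only [mul_sub, mul_smul_comm, mul_one, hw]
  have j1 := congrArg α as1
  have j2 := congrArg β as1
  have j3 := congrArg α as2
  have j4 := congrArg β as2
  simp only [map_add, map_sub, sα, sβ, αa, αb, βa, βb, α1, β1, ht, hu, αba, βba] at j1 j2 j3 j4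
  obtain rfl : v = u * u := by linear_combination j2
  obtain rfl : s = -(u * t) := by linear_combination -j1
  obtain rfl : w = t * t := by linear_combination j3
  obtain rfl : s' = -(u * t) := by linear_combination -j4
  have htab : ThreeDimTable u t a b := ⟨hv, hw, hab, hba⟩
  have hind : ∀ c x y c' x' y' : ZMod 3,
      c • (1 : R) + x • a + y • b = c' • (1 : R) + x' • a + y' • b →
      c = c' ∧ x = x' ∧ y = y' := by
    intro c x y c' x' y' H
    have k1 := congrArg α H
    have k2 := congrArg β H
    have k3 := congrArg (fun z => α (z * a)) H
    simp only [map_add, sα, sβ, αa, αb, βa, βb, α1, β1, add_mul, smul_mul_assoc, one_mul, αaa,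
      αba] at k1 k2 k3
    have hx : x = x' := by linear_combination k1
    have hy : y = y' := by linear_combination k2
    subst hx hy
    exact ⟨by linear_combination k3, rfl, rfl⟩
  have hspan (r : R) : ∃ c x y : ZMod 3, r = c • (1 : R) + x • a + y • b := by
    obtain ⟨c, hc⟩ := hD (r - α r • a - β r • b)
      (by simp only [map_sub, sα, αa, αb]; ring) (by simp only [map_sub, sβ, βa, βb]; ring)
    exact ⟨c, α r, β r, by rw [← hc]; abel⟩
  by_cases hut : u = 0 ∧ t = 0
  · left
    obtain ⟨rfl, rfl⟩ := hut
    obtain ⟨θ, hθ⟩ := htab.exists_ringHom ThreeDimTable.truncated hind hspan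
    refine hasQuotientIso_of_surjective θ fun m => ?_
    obtain ⟨p, rfl⟩ := Ideal.Quotient.mk_surjective m
    induction p using MvPolynomial.induction_on with
    | C c =>
      refine ⟨c • (1 : R) + (0 : ZMod 3) • a + (0 : ZMod 3) • b, ?_⟩
      rw [hθ]
      simp only [zero_smul, add_zero]
      rw [← Algebra.algebraMap_eq_smul_one]
      rfl
    | add p q hp hq =>
      obtain ⟨x, hx⟩ := hp
      obtain ⟨y, hy⟩ := hq
      exact ⟨x + y, by rw [map_add, hx, hy, map_add]⟩
    | mul_X p i hp =>
      obtain ⟨x, hx⟩ := hp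
      have ha := hθ 0 1 0
      have hb := hθ 0 0 1
      simp only [zero_smul, one_smul, zero_add, add_zero] at ha hb
      fin_cases i
      · exact ⟨x * a, by rw [map_mul, hx, ha, map_mul]; rfl⟩
      · exact ⟨x * b, by rw [map_mul, hx, hb, map_mul]; rfl⟩
  · right
    obtain ⟨θ, hθ⟩ := htab.exists_ringHom (ThreeDimTable.upperTriangular u t) hind hspan
    refine hasQuotientIso_of_surjective θ fun m => ?_
    rw [upperTriangular_eq_mk m]
    generalize m.1 0 0 = p
    generalize m.1 0 1 = q
    generalize m.1 1 1 = r
    -- Since −1 is not a square modulo 3, u² + t² is nonzero, hence its own inverse.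
    have hN : (u * u + t * t) * (u * u + t * t) = 1 := by
      clear * - hut
      revert u t
      decide
    -- Here 1/2 = −1. The coefficients x of `a` and y of `b` solve xu − yt = r − p, xt + yu = q,
    -- with determinant u² + t².
    refine ⟨(-(p + r)) • (1 : R) + ((u * u + t * t) * ((r - p) * u + q * t)) • a +
      ((u * u + t * t) * (q * u - (r - p) * t)) • b, ?_⟩
    rw [hθ, ← upperTriangularMk_one, upperTriangularMk_smul, upperTriangularMk_smul,
      upperTriangularMk_smul, upperTriangularMk_add, upperTriangularMk_add]
    congr 1
    · linear_combination (r - p) * hN - p * h3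
    · linear_combination q * hN
    · linear_combination (p - r) * hN - r * h3

end ReducedPencil

/-! ### Reduction modulo the ideal acting by zero. -/

section Pencil

variable {R : Type*} [Ring R] {α β : R →+ ZMod 3} {a b : R}

theorem HasQuotientIso.of_quotient {A : Type*} [Ring A] (I : Ideal R) [I.IsTwoSided]
    (h : HasQuotientIso (R ⧸ I) A) : HasQuotientIso R A := by
  obtain ⟨f, hf⟩ := h.exists_surjective
  exact hasQuotientIso_of_surjective (f.comp (Ideal.Quotient.mk I))
    (hf.comp Ideal.Quotient.mk_surjective)

theorem SubringPencil.hasQuotientIso (h : SubringPencil α β a b) :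
    HasQuotientIso R (TruncatedPolynomialTwo (ZMod 3)) ∨
      HasQuotientIso R (UpperTriangularTwo (ZMod 3)) := by
  let K : Ideal R :=
    { carrier := {k | α k = 0 ∧ β k = 0 ∧ α (k * a) = 0 ∧ α (a * k) = 0}
      add_mem' := fun {x y} hx hy => by
        obtain ⟨h1, h2, h3, h4⟩ := hx
        obtain ⟨k1, k2, k3, k4⟩ := hy
        simp only [Set.mem_ofPred_eq, map_add, add_mul, mul_add, h1, h2, h3, h4, k1, k2, k3, k4,
          add_zero, and_self]
      zero_mem' := by simp
      smul_mem' := fun x k hk => h.mul_kernel hk.1 hk.2.1 hk.2.2.1 hk.2.2.2 x }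
  have hK (k) : k ∈ K ↔ α k = 0 ∧ β k = 0 ∧ α (k * a) = 0 ∧ α (a * k) = 0 := Iff.rfl
  have : K.IsTwoSided := ⟨fun {k} x hk => h.kernel_mul hk.1 hk.2.1 hk.2.2.1 hk.2.2.2 x⟩
  let π : R →+* R ⧸ K := Ideal.Quotient.mk K
  have hπ : Function.Surjective π := Ideal.Quotient.mk_surjective
  let α' : R ⧸ K →+ ZMod 3 := QuotientAddGroup.lift K.toAddSubgroup α fun k hk => hk.1
  let β' : R ⧸ K →+ ZMod 3 := QuotientAddGroup.lift K.toAddSubgroup β fun k hk => hk.2.1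
  have hα (x) : α' (π x) = α x := rfl
  have hβ (x) : β' (π x) = β x := rfl
  have hp : SubringPencil α' β' (π a) (π b) := by
    refine ⟨h.fst_left, h.snd_left, h.fst_right, h.snd_right, ?_, ?_, ?_, ?_⟩ <;> intro x y <;>
      obtain ⟨x, rfl⟩ := hπ x <;> obtain ⟨y, rfl⟩ := hπ y
    · exact h.fst_mul x y
    · exact h.snd_mul x y
    · exact h.diag_mul x y
    · exact h.antidiag_mul x y
  have hred : ∀ d, α' d = 0 → β' d = 0 → α' (d * π a) = 0 → α' (π a * d) = 0 → d = 0 := by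
    intro d
    obtain ⟨d, rfl⟩ := hπ d
    intro h1 h2 h3 h4
    exact Ideal.Quotient.eq_zero_iff_mem.2 ⟨h1, h2, h3, h4⟩
  have : Nontrivial (R ⧸ K) := ⟨⟨π a, 0, fun H => by
    have := hα a
    rw [H, map_zero, h.fst_left] at this
    exact zero_ne_one this⟩⟩
  have h30 : ((3 : ℕ) : R ⧸ K) = 0 := by
    have e3 (f : R →+ ZMod 3) (x : R) : f (((3 : ℕ) : R) * x) = 0 := by
      rw [← nsmul_eq_mul, map_nsmul, nsmul_eq_mul]
      exact zero_mul _
    have e3' (f : R →+ ZMod 3) (x : R) : f (x * ((3 : ℕ) : R)) = 0 := by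
      rw [← nsmul_eq_mul', map_nsmul, nsmul_eq_mul]
      exact zero_mul _
    have : ((3 : ℕ) : R) ∈ K := (hK _).2
      ⟨by simpa using e3 α 1, by simpa using e3 β 1, e3 α a, e3' α a⟩
    have := Ideal.Quotient.eq_zero_iff_mem.2 this
    rwa [map_natCast] at this
  have : CharP (R ⧸ K) 3 := (CharP.charP_iff_prime_eq_zero Nat.prime_three).2 h30
  let _ : Algebra (ZMod 3) (R ⧸ K) := ZMod.algebra _ 3
  by_cases heq : ∀ d, α' d = 0 → β' d = 0 → α' (d * π a) = α' (π a * d)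
  · exact (hp.hasQuotientIso_of_forall_eq hred heq).imp (.of_quotient K) (.of_quotient K)
  · push Not at heq
    obtain ⟨d, h1, h2, h3⟩ := heq
    exact Or.inr (.of_quotient K (hp.hasQuotientIso_of_ne hred h1 h2 h3))

end Pencil

/-! ### Irredundant covers by four subrings; the index 3 case. -/

section Irredundant

variable {R : Type*} [Ring R]

theorem AddSubgroup.exists_functional_of_prime_index {G : Type*} [AddCommGroup G]
    (H : AddSubgroup G) {p : ℕ} (hp : p.Prime) (h : H.index = p) :
    ∃ f : G →+ ZMod p, ∀ x, f x = 0 ↔ x ∈ H := by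
  have : Fact p.Prime := ⟨hp⟩
  have hc : IsAddCyclic (G ⧸ H) := isAddCyclic_of_prime_card (p := p) h
  subst h
  let e : ZMod H.index ≃+ G ⧸ H := zmodAddCyclicAddEquiv hc
  refine ⟨(e.symm : G ⧸ H →+ ZMod H.index).comp (QuotientAddGroup.mk' H), fun x => ?_⟩
  simp

theorem exists_mem_four_erase : ∀ i : Fin 4,
    ∃ j k l : Fin 4, ∀ m, m ≠ i → m = j ∨ m = k ∨ m = l := by
  decide

theorem irredundant_of_not_hasThreeCover (hno : ¬ HasThreeCover R)
    (S : Fin 4 → NonUnitalSubring R) (hS : ∀ i, S i ≠ ⊤) (i : Fin 4) :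
    ∃ y, ∀ j, j ≠ i → y ∉ S j := by
  by_contra! H
  obtain ⟨j, k, l, hm⟩ := exists_mem_four_erase i
  refine hno ⟨S j, S k, S l, hS j, hS k, hS l, fun x => ?_⟩
  obtain ⟨m, hmi, hx⟩ := H x
  rcases hm m hmi with rfl | rfl | rfl <;> simp [hx]

/-- Add to `x` an element `y` lying only in `S i`: the sum avoids the other members, so it lies in
`S i`, and so does `x`. -/
theorem mem_of_mem_others {S : Fin 4 → NonUnitalSubring R} (hc : ∀ x, ∃ i, x ∈ S i)
    (hirr : ∀ i, ∃ y, ∀ j, j ≠ i → y ∉ S j) {i : Fin 4} {x : R} (hx : ∀ j, j ≠ i → x ∈ S j) :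
    x ∈ S i := by
  obtain ⟨y, hy⟩ := hirr i
  have key (j) (h : x + y ∈ S j) : j = i := by
    by_contra hji
    exact hy j hji (by simpa using (S j).sub_mem h (hx j hji))
  obtain ⟨j, hj⟩ := hc (x + y)
  obtain rfl := key j hj
  obtain ⟨k, hk⟩ := hc y
  obtain rfl : k = j := by
    by_contra hkj
    exact hy k hkj hk
  simpa using (S k).sub_mem hj hk

/-- Adjoining the identity to a proper subring either gives a proper subring or everything. -/
theorem exists_proper_one_mem_or_complement (T : NonUnitalSubring R) (hT : T ≠ ⊤) :
    ∃ T' : NonUnitalSubring R, T ≤ T' ∧ T' ≠ ⊤ ∧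
      (1 ∈ T' ∨ ∀ r, ∃ s ∈ T', ∃ n : ℤ, r = s + n) := by
  let U : NonUnitalSubring R :=
    { carrier := {r | ∃ s ∈ T, ∃ n : ℤ, r = s + n}
      add_mem' := by
        rintro _ _ ⟨s, hs, n, rfl⟩ ⟨s', hs', n', rfl⟩
        exact ⟨s + s', T.add_mem hs hs', n + n', by push_cast; abel⟩
      zero_mem' := ⟨0, T.zero_mem, 0, by simp⟩
      neg_mem' := by
        rintro _ ⟨s, hs, n, rfl⟩
        exact ⟨-s, T.neg_mem hs, -n, by push_cast; abel⟩
      mul_mem' := by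
        rintro _ _ ⟨s, hs, n, rfl⟩ ⟨s', hs', n', rfl⟩
        refine ⟨s * s' + n' • s + n • s', T.add_mem (T.add_mem (T.mul_mem hs hs')
          (zsmul_mem hs _)) (zsmul_mem hs' _), n * n', ?_⟩
        simp only [zsmul_eq_mul, mul_add, add_mul, Int.cast_mul, (Int.cast_commute n' s).eq]
        abel }
  have hTU : T ≤ U := fun s hs => ⟨s, hs, 0, by simp⟩
  by_cases hU : U = ⊤
  · refine ⟨T, le_rfl, hT, Or.inr fun r => ?_⟩
    exact (hU ▸ NonUnitalSubring.mem_top r : r ∈ U)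
  · exact ⟨U, hTU, hU, Or.inl ⟨0, T.zero_mem, 1, by simp⟩⟩

/-- If xy left ker γ, then T would contain ker γ and an element outside it; as the target has prime
order, T would be everything. -/
theorem ker_mul_closed_of_le {γ : R →+ ZMod 3} {T : NonUnitalSubring R} (hT : T ≠ ⊤)
    (h : ∀ x, γ x = 0 → x ∈ T) (x y : R) (hx : γ x = 0) (hy : γ y = 0) : γ (x * y) = 0 := by
  by_contra hxy
  refine hT (eq_top_iff.2 fun r _ => ?_)
  have hm : x * y ∈ T := T.mul_mem (h x hx) (h y hy)
  have hr : r - (γ r / γ (x * y)).val • (x * y) ∈ T := h _ (by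
    rw [map_sub, map_nsmul, nsmul_eq_mul, ZMod.natCast_zmod_val, div_mul_cancel₀ _ hxy, sub_self])
  simpa using T.add_mem hr (nsmul_mem hm (γ r / γ (x * y)).val)

theorem hasQuotientIso_of_index_three {S : Fin 4 → NonUnitalSubring R} (hS : ∀ i, S i ≠ ⊤)
    (hc : ∀ x, ∃ i, x ∈ S i) (hirr : ∀ i, ∃ y, ∀ j, j ≠ i → y ∉ S j)
    (h3 : ∀ i, (S i).toAddSubgroup.index = 3) :
    HasQuotientIso R (TruncatedPolynomialTwo (ZMod 3)) ∨
      HasQuotientIso R (UpperTriangularTwo (ZMod 3)) := by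
  obtain ⟨α, hα⟩ := (S 0).toAddSubgroup.exists_functional_of_prime_index Nat.prime_three (h3 0)
  obtain ⟨β, hβ⟩ := (S 1).toAddSubgroup.exists_functional_of_prime_index Nat.prime_three (h3 1)
  have hα (x) : α x = 0 ↔ x ∈ S 0 := hα x
  have hβ (x) : β x = 0 ↔ x ∈ S 1 := hβ x
  have hthree (i) (x : R) : 3 • x ∈ S i := by
    have := (S i).toAddSubgroup.nsmul_index_mem x
    rwa [h3 i] at this
  have own (i) : ∃ y ∈ S i, ∀ j, j ≠ i → y ∉ S j := by
    obtain ⟨y, hy⟩ := hirr i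
    obtain ⟨j, hj⟩ := hc y
    obtain rfl : j = i := by
      by_contra h
      exact hy j h hj
    exact ⟨y, hj, hy⟩
  -- If z in S₀ ∩ S₁ avoids `S k` and y lies only in `S k`, then y + z and y + 2z both lie in `S l`.
  -- So z lies in every member but `S k`, which `mem_of_mem_others` forbids.
  have hD (k l : Fin 4) (hk0 : k ≠ 0) (hk1 : k ≠ 1) (hkl : l ≠ k)
      (hall : ∀ m, m = 0 ∨ m = 1 ∨ m = k ∨ m = l) (z : R) (hz0 : z ∈ S 0) (hz1 : z ∈ S 1) :
      z ∈ S k := by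
    by_contra hz
    obtain ⟨y, hyk, hy⟩ := own k
    have mem (t : R) (ht0 : t ∈ S 0) (ht1 : t ∈ S 1) (htk : t ∉ S k) : y + t ∈ S l := by
      obtain ⟨m, hm⟩ := hc (y + t)
      rcases hall m with rfl | rfl | rfl | rfl
      · exact absurd (by simpa using (S 0).sub_mem hm ht0) (hy 0 (Ne.symm hk0))
      · exact absurd (by simpa using (S 1).sub_mem hm ht1) (hy 1 (Ne.symm hk1))
      · exact absurd (by simpa using (S m).sub_mem hm hyk) htk
      · exact hm
    have m1 := mem z hz0 hz1 hz
    have m2 := mem (z + z) ((S 0).add_mem hz0 hz0) ((S 1).add_mem hz1 hz1) fun h => hz (by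
      have := (S k).sub_mem (hthree k z) h
      convert this using 1
      abel)
    have hzl : z ∈ S l := by
      have := (S l).sub_mem m2 m1
      convert this using 1
      abel
    refine hz (mem_of_mem_others hc hirr fun j hj => ?_)
    rcases hall j with rfl | rfl | rfl | rfl
    exacts [hz0, hz1, absurd rfl hj, hzl]
  have hD2 := hD 2 3 (by decide) (by decide) (by decide) (by decide)
  have hD3 := hD 3 2 (by decide) (by decide) (by decide) (by decide)
  have hsq : ∀ p : ZMod 3, p ≠ 0 → p * p = 1 := by decide
  obtain ⟨a, αa, βa⟩ : ∃ a, α a = 1 ∧ β a = 0 := by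
    obtain ⟨y, hy1, hy⟩ := own 1
    have hy0 : α y ≠ 0 := fun h => hy 0 (by decide) ((hα y).1 h)
    refine ⟨(α y).val • y, ?_, (hβ _).2 (nsmul_mem hy1 _)⟩
    rw [map_nsmul, nsmul_eq_mul, ZMod.natCast_zmod_val, hsq _ hy0]
  obtain ⟨b, αb, βb⟩ : ∃ b, α b = 0 ∧ β b = 1 := by
    obtain ⟨y, hy1, hy⟩ := own 0
    have hy0 : β y ≠ 0 := fun h => hy 1 (by decide) ((hβ y).1 h)
    refine ⟨(β y).val • y, (hα _).2 (nsmul_mem hy1 _), ?_⟩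
    rw [map_nsmul, nsmul_eq_mul, ZMod.natCast_zmod_val, hsq _ hy0]
  -- The remaining lines are spanned by a ± b modulo D; whichever of S₂, S₃ contains that element
  -- contains the whole line.
  have line (c : R) (ε : ZMod 3) (hε : ε * ε = 1) (c1 : α c = 1) (c2 : β c = ε) :
      ∃ T : NonUnitalSubring R, T ≠ ⊤ ∧ ∀ x, α x = ε * β x → x ∈ T := by
    have red (T : NonUnitalSubring R) (hcT : c ∈ T) (hDT : ∀ z, z ∈ S 0 → z ∈ S 1 → z ∈ T)
        (x : R) (hx : α x = ε * β x) : x ∈ T := by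
      have : x - (α x).val • c ∈ T := by
        refine hDT _ ((hα _).1 ?_) ((hβ _).1 ?_)
        · rw [map_sub, map_nsmul, c1, nsmul_eq_mul, ZMod.natCast_zmod_val]; ring
        · rw [map_sub, map_nsmul, c2, nsmul_eq_mul, ZMod.natCast_zmod_val]
          linear_combination (-ε) * hx - β x * hε
      simpa using T.add_mem this (nsmul_mem hcT (α x).val)
    obtain ⟨m, hm⟩ := hc c
    have hm4 : ∀ m : Fin 4, m = 0 ∨ m = 1 ∨ m = 2 ∨ m = 3 := by decide
    rcases hm4 m with rfl | rfl | rfl | rfl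
    · rw [← hα, c1] at hm
      exact absurd hm one_ne_zero
    · rw [← hβ, c2] at hm
      rw [hm, mul_zero] at hε
      exact absurd hε zero_ne_one
    · exact ⟨S 2, hS 2, red _ hm hD2⟩
    · exact ⟨S 3, hS 3, red _ hm hD3⟩
  obtain ⟨T, hT, hTm⟩ := line (a + b) 1 (by decide) (by rw [map_add, αa, αb, add_zero])
    (by rw [map_add, βa, βb, zero_add])
  obtain ⟨T', hT', hTm'⟩ := line (a - b) (-1) (by decide) (by rw [map_sub, αa, αb, sub_zero])
    (by rw [map_sub, βa, βb, zero_sub])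
  have hp : SubringPencil α β a b :=
    { fst_left := αa
      snd_left := βa
      fst_right := αb
      snd_right := βb
      fst_mul := fun x y hx hy => (hα _).2 ((S 0).mul_mem ((hα _).1 hx) ((hα _).1 hy))
      snd_mul := fun x y hx hy => (hβ _).2 ((S 1).mul_mem ((hβ _).1 hx) ((hβ _).1 hy))
      diag_mul := fun x y hx hy => by
        have := ker_mul_closed_of_le (γ := α - β) hT (fun z hz => hTm z (by
          rw [one_mul]; exact sub_eq_zero.1 hz)) x y (sub_eq_zero.2 hx) (sub_eq_zero.2 hy)
        exact sub_eq_zero.1 this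
      antidiag_mul := fun x y hx hy => by
        have := ker_mul_closed_of_le (γ := α + β) hT' (fun z hz => hTm' z (by
          rw [neg_one_mul]; exact eq_neg_of_add_eq_zero_left hz)) x y
          (by rw [AddMonoidHom.add_apply, hx]; ring) (by rw [AddMonoidHom.add_apply, hy]; ring)
        exact eq_neg_of_add_eq_zero_left this }
  exact hp.hasQuotientIso

end Irredundant

/-! ### Covers with two members of index 2. -/

section TwoIndexTwo

variable {R : Type*} [Ring R]

theorem AddMonoidHom.eq_of_ker_le {G : Type*} [AddCommGroup G] {f g : G →+ ZMod 2}
    (hg : ∃ x, g x ≠ 0) (h : ∀ x, f x = 0 → g x = 0) : f = g := by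
  obtain ⟨y, hy⟩ := hg
  have hy1 := (ZMod.two_cases (g y)).resolve_left hy
  have hf1 := (ZMod.two_cases (f y)).resolve_left fun h0 => hy (h y h0)
  ext x
  rcases ZMod.two_cases (f x) with hx | hx
  · rw [hx, h x hx]
  · have := h (x - y) (by rw [map_sub, hx, hf1, sub_self])
    rw [map_sub, sub_eq_zero] at this
    rw [hx, this, hy1]

/-- A proper ideal with quotient generated by `1` and killed by `4` lies in the kernel of a
character to `𝔽₂`. -/
theorem exists_ringHom_zmod_two {T : NonUnitalSubring R} (hT : T ≠ ⊤) (h4 : ∀ r : R, 4 • r ∈ T)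
    (hcomp : ∀ r, ∃ s ∈ T, ∃ n : ℤ, r = s + n) : ∃ χ : R →+* ZMod 2, ∀ x ∈ T, χ x = 0 := by
  have zmul (n : ℤ) {t : R} (ht : t ∈ T) : (n : R) * t ∈ T := by
    rw [← zsmul_eq_mul]; exact zsmul_mem ht n
  have mulz (n : ℤ) {t : R} (ht : t ∈ T) : t * (n : R) ∈ T := by
    rw [← (Int.cast_commute n t).eq]; exact zmul n ht
  have hmul (t x : R) (ht : t ∈ T) : x * t ∈ T := by
    obtain ⟨s, hs, n, rfl⟩ := hcomp x
    rw [add_mul]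
    exact T.add_mem (T.mul_mem hs ht) (zmul n ht)
  have h1 : (1 : R) ∉ T := fun h => hT (eq_top_iff.2 fun r _ => by simpa using hmul 1 r h)
  -- An odd integer in T, together with 4, would put 1 in the ideal T.
  have hpar (n : ℤ) (hn : (n : R) ∈ T) : ((n : ℤ) : ZMod 2) = 0 := by
    rw [ZMod.intCast_zmod_eq_zero_iff_dvd]
    by_contra hodd
    have : n % 4 = 1 ∨ n % 4 = 3 := by
      have : ¬ (2 : ℤ) ∣ n := by exact_mod_cast hodd
      omega
    refine h1 ?_
    have e4 (m : ℤ) : ((4 * m : ℤ) : R) ∈ T := by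
      have := h4 (m : R)
      rw [nsmul_eq_mul] at this
      exact_mod_cast this
    rcases this with h | h
    · have := T.sub_mem hn (e4 (n / 4))
      rw [← Int.cast_sub, show n - 4 * (n / 4) = 1 by omega, Int.cast_one] at this
      exact this
    · have := T.sub_mem (e4 (n / 4 + 1)) hn
      rw [← Int.cast_sub, show 4 * (n / 4 + 1) - n = 1 by omega, Int.cast_one] at this
      exact this
  have hcomp' (r : R) : ∃ n : ℤ, r - n ∈ T := by
    obtain ⟨s, hs, n, rfl⟩ := hcomp r
    exact ⟨n, by simpa using hs⟩
  choose N hN using hcomp'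
  have heq (r : R) (n : ℤ) (h : r - n ∈ T) : ((N r : ℤ) : ZMod 2) = n := by
    rw [← sub_eq_zero, ← Int.cast_sub]
    refine hpar _ ?_
    have := T.sub_mem h (hN r)
    rw [Int.cast_sub]
    convert this using 1
    abel
  refine ⟨
    { toFun := fun r => ((N r : ℤ) : ZMod 2)
      map_one' := by simpa using heq 1 1 (by simp)
      map_zero' := by simpa using heq 0 0 (by simp)
      map_add' := fun x y => by
        have := heq (x + y) (N x + N y) (by
          have := T.add_mem (hN x) (hN y)
          push_cast
          convert this using 1
          abel)
        rw [this, Int.cast_add]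
      map_mul' := fun x y => by
        have := heq (x * y) (N x * N y) (by
          have := T.add_mem (hmul _ x (hN y)) (mulz (N y) (hN x))
          push_cast
          convert this using 1
          noncomm_ring)
        rw [this, Int.cast_mul] }, fun x hx => by simpa using heq x 0 (by simpa using hx)⟩

/-- The functional `f` is a nonzero coordinate of a homomorphism onto the field of order `4`. -/
def IsGaloisCoordinate (f : R →+ ZMod 2) (φ : R →+* GaloisField 2 2) (w : GaloisField 2 2)
    (u : R → ZMod 2) : Prop :=
  w ^ 2 + w + 1 = 0 ∧
    ∀ x, φ x = algebraMap (ZMod 2) _ (u x) + algebraMap (ZMod 2) _ (f x) * w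

theorem IsGaloisCoordinate.root {f : R →+ ZMod 2} {φ : R →+* GaloisField 2 2}
    {w : GaloisField 2 2} {u : R → ZMod 2} (h : IsGaloisCoordinate f φ w u) {x : R}
    (hx : f x ≠ 0) : φ x ^ 2 + φ x + 1 = 0 := by
  have h2 : (2 : GaloisField 2 2) = 0 := CharTwo.two_eq_zero
  rw [h.2, (ZMod.two_cases (f x)).resolve_left hx, map_one, one_mul]
  rcases ZMod.two_cases (u x) with hu | hu <;> rw [hu]
  · rw [map_zero, zero_add]; exact h.1
  · rw [map_one]; linear_combination h.1 + (1 + w) * h2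

theorem IsGaloisCoordinate.eq_zero_or_one {f : R →+ ZMod 2} {φ : R →+* GaloisField 2 2}
    {w : GaloisField 2 2} {u : R → ZMod 2} (h : IsGaloisCoordinate f φ w u) {x : R}
    (hx : f x = 0) : φ x = 0 ∨ φ x = 1 := by
  rw [h.2, hx, map_zero, zero_mul, add_zero]
  rcases ZMod.two_cases (u x) with hu | hu <;> rw [hu] <;> simp

theorem IsGaloisCoordinate.surjective {f : R →+ ZMod 2} {φ : R →+* GaloisField 2 2}
    {w : GaloisField 2 2} {u : R → ZMod 2} (h : IsGaloisCoordinate f φ w u)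
    (hf : ∃ x, f x ≠ 0) : Function.Surjective φ := by
  obtain ⟨x, hx⟩ := hf
  have hr := h.root hx
  have h2 : (2 : GaloisField 2 2) = 0 := CharTwo.two_eq_zero
  intro y
  rcases GaloisField.four_eq y with rfl | rfl | hy
  · exact ⟨0, map_zero φ⟩
  · exact ⟨1, map_one φ⟩
  · have : (y - φ x) * (y - φ x - 1) = 0 := by
      linear_combination hy - hr - (y * φ x + y - φ x ^ 2 - φ x) * h2
    rcases mul_eq_zero.1 this with e | e
    · exact ⟨x, by linear_combination -e⟩
    · exact ⟨x + 1, by rw [map_add, map_one]; linear_combination -e⟩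

/-- The kernel of `f` is the preimage of F₂, that is, ker φ + ℤ·1. Thus ker φ ⊆ ker ψ would give ker
f ⊆ ker g, forcing f = g. -/
theorem IsGaloisCoordinate.exists_ker_not_ker {f g : R →+ ZMod 2} {φ ψ : R →+* GaloisField 2 2}
    {w w' : GaloisField 2 2} {u u' : R → ZMod 2} (h : IsGaloisCoordinate f φ w u)
    (h' : IsGaloisCoordinate g ψ w' u') (hg : ∃ x, g x ≠ 0) (hne : f ≠ g) :
    ∃ z, φ z = 0 ∧ ψ z ≠ 0 := by
  by_contra! H
  refine hne (AddMonoidHom.eq_of_ker_le hg fun x hx => ?_)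
  by_contra hgx
  have hr := h'.root hgx
  rcases h.eq_zero_or_one hx with e | e
  · rw [H x e] at hr
    simp at hr
  · have := H (x - 1) (by rw [map_sub, e, map_one, sub_self])
    rw [map_sub, map_one, sub_eq_zero] at this
    have h2 : (2 : GaloisField 2 2) = 0 := CharTwo.two_eq_zero
    rw [this] at hr
    exact one_ne_zero (α := GaloisField 2 2) (by linear_combination hr - h2)

theorem hasQuotientIso_galoisField_prod {f g : R →+ ZMod 2} {φ ψ : R →+* GaloisField 2 2}
    {w w' : GaloisField 2 2} {u u' : R → ZMod 2} (h : IsGaloisCoordinate f φ w u)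
    (h' : IsGaloisCoordinate g ψ w' u') (hf : ∃ x, f x ≠ 0) (hg : ∃ x, g x ≠ 0) (hne : f ≠ g) :
    HasQuotientIso R (GaloisField 2 2 × GaloisField 2 2) := by
  obtain ⟨z, hz1, hz2⟩ := h.exists_ker_not_ker h' hg hne
  obtain ⟨z', hz1', hz2'⟩ := h'.exists_ker_not_ker h hf hne.symm
  refine hasQuotientIso_of_surjective (φ.prod ψ) fun ⟨p, q⟩ => ?_
  obtain ⟨r, hr⟩ := h.surjective hf (p / φ z')
  obtain ⟨s, hs⟩ := h'.surjective hg (q / ψ z)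
  refine ⟨r * z' + s * z, Prod.ext ?_ ?_⟩
  · simp [hr, hz1, hz2']
  · simp [hs, hz1', hz2]

/-- An element with nontrivial coordinates generates modulo the common kernel of a Galois
coordinate and a derivation. -/
theorem exists_mem_sub_mem_ker {f g : R →+ ZMod 2} {φ : R →+* GaloisField 2 2}
    {w : GaloisField 2 2} {u : R → ZMod 2} {χ : R →+* ZMod 2} (h : IsGaloisCoordinate f φ w u)
    (hg : ∀ x y, g (x * y) = χ x * g y + g x * χ y) {x : R} (hfx : f x = 1) (hgx : g x = 1)
    (hχx : χ x = 1) {T : NonUnitalSubring R} (hxT : x ∈ T) (h1T : (1 : R) ∈ T) (r : R) :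
    ∃ s ∈ T, φ (r - s) = 0 ∧ g (r - s) = 0 := by
  have h2 : (2 : GaloisField 2 2) = 0 := CharTwo.two_eq_zero
  have g1 : g 1 = 0 := by
    have := hg 1 1
    rw [mul_one, map_one χ, one_mul, mul_one] at this
    simpa using this
  have hW := h.root (x := x) (by rw [hfx]; exact one_ne_zero)
  -- Under φ and χ + gε, the element `x` goes to (ω, 1 + ε) in F₄ × F₂[ε]. There x³ − 1 becomes (0,
  -- ε), and `y₂` below becomes (1, 0).
  obtain ⟨y₁, hy₁, hφ₁, hχ₁, hg₁⟩ : ∃ y ∈ T, φ y = 0 ∧ χ y = 0 ∧ g y = 1 := by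
    refine ⟨x * x * x - 1, T.sub_mem (T.mul_mem (T.mul_mem hxT hxT) hxT) h1T, ?_, ?_, ?_⟩
    · rw [map_sub, map_mul, map_mul, map_one]; linear_combination (φ x - 1) * hW
    · simp [hχx]
    · simp only [map_sub, hg, map_mul, hχx, hgx, g1]; decide
  obtain ⟨y₂, hy₂, hφ₂, hχ₂, hg₂⟩ : ∃ y ∈ T, φ y = 1 ∧ χ y = 0 ∧ g y = 0 := by
    refine ⟨x + x * x - y₁, T.sub_mem (T.add_mem hxT (T.mul_mem hxT hxT)) hy₁, ?_, ?_, ?_⟩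
    · rw [map_sub, map_add, map_mul, hφ₁]; linear_combination hW - h2
    · simp only [map_sub, map_add, map_mul, hχx, hχ₁]; decide
    · simp only [map_sub, map_add, hg, hχx, hgx, hg₁]; decide
  obtain ⟨p, hp⟩ : ∃ p : ZMod 2, φ r = algebraMap _ _ p + algebraMap _ _ (f r) * φ x := by
    refine ⟨u r - f r * u x, ?_⟩
    rw [h.2 r, h.2 x, hfx, map_sub, map_mul, map_one]
    ring
  have cast (q : ZMod 2) : ((q.val : ℕ) : GaloisField 2 2) = algebraMap _ _ q := by
    rw [← map_natCast (algebraMap (ZMod 2) (GaloisField 2 2)), ZMod.natCast_zmod_val]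
  refine ⟨p.val • y₂ + (f r).val • (x * y₂) + (g r).val • y₁,
    T.add_mem (T.add_mem (nsmul_mem hy₂ _) (nsmul_mem (T.mul_mem hxT hy₂) _)) (nsmul_mem hy₁ _),
    ?_, ?_⟩
  · simp only [map_sub, map_add, map_nsmul, map_mul, hφ₁, hφ₂, hp]
    simp only [nsmul_eq_mul, cast]
    ring
  · simp only [map_sub, map_add, map_nsmul, hg, hg₁, hg₂, hχ₂]
    simp only [nsmul_eq_mul, ZMod.natCast_zmod_val]
    ring

theorem exists_four_distinct : ∀ i j : Fin 4, i ≠ j → ∃ k l : Fin 4, k ≠ i ∧ k ≠ j ∧ l ≠ i ∧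
    l ≠ j ∧ k ≠ l ∧ ∀ m, m = i ∨ m = j ∨ m = k ∨ m = l := by
  decide

theorem hasQuotientIso_of_two_index_two (hno : ¬ HasThreeCover R)
    {S : Fin 4 → NonUnitalSubring R} (hS : ∀ i, S i ≠ ⊤)
    (hc : ∀ x, ∃ i, x ∈ S i) (hirr : ∀ i, ∃ y, ∀ j, j ≠ i → y ∉ S j)
    (hone : ∀ i, 1 ∈ S i ∨ ∀ r, ∃ s ∈ S i, ∃ n : ℤ, r = s + n) {i j : Fin 4} (hij : i ≠ j)
    (hi : (S i).toAddSubgroup.index = 2) (hj : (S j).toAddSubgroup.index = 2) :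
    HasQuotientIso R (GaloisField 2 2 × GaloisField 2 2) ∨
      HasQuotientIso R (Matrix (Fin 2) (Fin 2) (ZMod 2)) := by
  have own (i) : ∃ y ∈ S i, ∀ j, j ≠ i → y ∉ S j := by
    obtain ⟨y, hy⟩ := hirr i
    obtain ⟨j, hj⟩ := hc y
    obtain rfl : j = i := by
      by_contra h
      exact hy j h hj
    exact ⟨y, hj, hy⟩
  obtain ⟨k, l, hki, hkj, hli, hlj, hkl, hall⟩ := exists_four_distinct i j hij
  -- So S i ∩ S j ∩ S k has index at most 2 in S i ∩ S j. If y lies only in `S k` and t − t' were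
  -- outside it, then y + (t − t'), y + t' and y + t would lie in `S l`, hence y too.
  have hQ (k l : Fin 4) (hki : k ≠ i) (hkj : k ≠ j) (hkl : k ≠ l)
      (hall : ∀ m, m = i ∨ m = j ∨ m = k ∨ m = l) (t t' : R) (hti : t ∈ S i) (htj : t ∈ S j)
      (hti' : t' ∈ S i) (htj' : t' ∈ S j) (htk : t ∉ S k) (htk' : t' ∉ S k) : t - t' ∈ S k := by
    by_contra hk
    obtain ⟨y, hyk, hy⟩ := own k
    have mem (t : R) (hti : t ∈ S i) (htj : t ∈ S j) (htk : t ∉ S k) : y + t ∈ S l := by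
      obtain ⟨m, hm⟩ := hc (y + t)
      rcases hall m with rfl | rfl | rfl | rfl
      · exact absurd (by simpa using (S m).sub_mem hm hti) (hy m (Ne.symm hki))
      · exact absurd (by simpa using (S m).sub_mem hm htj) (hy m (Ne.symm hkj))
      · exact absurd (by simpa using (S m).sub_mem hm hyk) htk
      · exact hm
    refine hy l hkl.symm ?_
    have := (S l).sub_mem ((S l).add_mem
      (mem (t - t') ((S i).sub_mem hti hti') ((S j).sub_mem htj htj') hk) (mem t' hti' htj' htk'))
      (mem t hti htj htk)
    convert this using 1
    abel
  have two_i (r : R) : 2 • r ∈ S i := by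
    have := (S i).toAddSubgroup.nsmul_index_mem r
    rwa [hi] at this
  have two_j (r : R) : 2 • r ∈ S j := by
    have := (S j).toAddSubgroup.nsmul_index_mem r
    rwa [hj] at this
  have four_of (k l : Fin 4) (hki : k ≠ i) (hkj : k ≠ j) (hkl : k ≠ l)
      (hall : ∀ m, m = i ∨ m = j ∨ m = k ∨ m = l) (r : R) : 4 • r ∈ S k := by
    rw [show 4 • r = 2 • r + 2 • r by rw [← add_nsmul]]
    by_cases h : 2 • r ∈ S k
    · exact (S k).add_mem h h
    · have := hQ k l hki hkj hkl hall (2 • r) (-(2 • r)) (two_i r) (two_j r)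
        ((S i).neg_mem (two_i r)) ((S j).neg_mem (two_j r)) h (fun h' => h (by
          simpa using (S k).neg_mem h'))
      rwa [sub_neg_eq_add] at this
  have four (m : Fin 4) (r : R) : 4 • r ∈ S m := by
    rcases hall m with rfl | rfl | rfl | rfl
    · rw [show 4 • r = 2 • (2 • r) by rw [← mul_nsmul]]; exact two_i _
    · rw [show 4 • r = 2 • (2 • r) by rw [← mul_nsmul]]; exact two_j _
    · exact four_of m l hki hkj hkl hall r
    · exact four_of m k hli hlj hkl.symm (fun n => by
        rcases hall n with h | h | h | h <;> simp [h]) r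
  -- If 1 is missing from one member, it is missing from a second. Each lies in the kernel of a
  -- character to F₂; a common kernel replaces both members, and distinct characters give a cover by
  -- three.
  have one_mem (m : Fin 4) : (1 : R) ∈ S m := by
    by_contra hm
    obtain ⟨m', hmm, hm'⟩ : ∃ m', m' ≠ m ∧ (1 : R) ∉ S m' := by
      by_contra! H
      exact hm (mem_of_mem_others hc hirr H)
    obtain ⟨χ, hχ⟩ := exists_ringHom_zmod_two (hS m) (four m) ((hone m).resolve_left hm)
    obtain ⟨ψ, hψ⟩ := exists_ringHom_zmod_two (hS m') (four m') ((hone m').resolve_left hm')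
    by_cases hne : χ = ψ
    · subst hne
      obtain ⟨k, l, -, -, -, -, -, hall⟩ := exists_four_distinct m' m hmm
      refine hno ⟨kerSubring (χ : R →+ ZMod 2) fun x y hx hy => ?_, S k, S l,
        kerSubring_ne_top (x := 1) (by simp), hS k, hS l, fun x => ?_⟩
      · simp_all
      · obtain ⟨n, hn⟩ := hc x
        rcases hall n with rfl | rfl | rfl | rfl
        · exact Or.inl (hψ x hn)
        · exact Or.inl (hχ x hn)
        · exact Or.inr (Or.inl hn)
        · exact Or.inr (Or.inr hn)
    · exact hno (hasThreeCover_of_ringHom_ne χ ψ hne)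
  have functional (m : Fin 4) (hm : (S m).toAddSubgroup.index = 2) :
      ∃ f : R →+ ZMod 2, ∀ x, f x = 0 ↔ x ∈ S m :=
    (S m).toAddSubgroup.exists_functional_of_prime_index Nat.prime_two hm
  have nonzero (m : Fin 4) (f : R →+ ZMod 2) (hf : ∀ x, f x = 0 ↔ x ∈ S m) : ∃ x, f x ≠ 0 := by
    by_contra! H
    exact hS m (eq_top_iff.2 fun x _ => (hf x).1 (H x))
  have distinct (m n : Fin 4) (hmn : m ≠ n) (f g : R →+ ZMod 2) (hf : ∀ x, f x = 0 ↔ x ∈ S m)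
      (hg : ∀ x, g x = 0 ↔ x ∈ S n) : f ≠ g := by
    rintro rfl
    obtain ⟨y, hy, hy'⟩ := own m
    exact hy' n hmn.symm ((hg y).1 ((hf y).2 hy))
  by_cases hM : HasQuotientIso R (Matrix (Fin 2) (Fin 2) (ZMod 2))
  · exact Or.inr hM
  left
  have kind (m : Fin 4) (f : R →+ ZMod 2) (hf : ∀ x, f x = 0 ↔ x ∈ S m) :
      (∃ χ : R →+* ZMod 2, ∀ x y, f (x * y) = χ x * f y + f x * χ y) ∨
      ∃ φ w u, IsGaloisCoordinate f φ w u := by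
    rcases index_two_cases f (fun x y hx hy => (hf _).2 ((S m).mul_mem ((hf x).1 hx) ((hf y).1 hy)))
      ((hf 1).2 (one_mem m)) (nonzero m f hf) with h | h | h | h
    · exact absurd h hno
    · exact absurd h hM
    · exact Or.inl h
    · exact Or.inr h
  have der_der (m n : Fin 4) (hmn : m ≠ n) (f g : R →+ ZMod 2) (hf : ∀ x, f x = 0 ↔ x ∈ S m)
      (hg : ∀ x, g x = 0 ↔ x ∈ S n)
      (hf' : ∃ χ : R →+* ZMod 2, ∀ x y, f (x * y) = χ x * f y + f x * χ y)
      (hg' : ∃ χ : R →+* ZMod 2, ∀ x y, g (x * y) = χ x * g y + g x * χ y) : False := by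
    obtain ⟨χ, hχ⟩ := hf'
    obtain ⟨ψ, hψ⟩ := hg'
    by_cases hne : χ = ψ
    · subst hne
      exact hno (hasThreeCover_of_derivations χ f g (nonzero m f hf) (nonzero n g hg)
        (distinct m n hmn f g hf hg) hχ hψ)
    · exact hno (hasThreeCover_of_ringHom_ne χ ψ hne)
  have gal_gal (m n : Fin 4) (hmn : m ≠ n) (f g : R →+ ZMod 2) (hf : ∀ x, f x = 0 ↔ x ∈ S m)
      (hg : ∀ x, g x = 0 ↔ x ∈ S n) (hf' : ∃ φ w u, IsGaloisCoordinate f φ w u)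
      (hg' : ∃ φ w u, IsGaloisCoordinate g φ w u) :
      HasQuotientIso R (GaloisField 2 2 × GaloisField 2 2) := by
    obtain ⟨φ, w, u, h⟩ := hf'
    obtain ⟨φ', w', u', h'⟩ := hg'
    exact hasQuotientIso_galoisField_prod h h' (nonzero m f hf) (nonzero n g hg)
      (distinct m n hmn f g hf hg)
  have mixed (i j k l : Fin 4) (hki : k ≠ i) (hkj : k ≠ j) (hli : l ≠ i) (hlj : l ≠ j)
      (hkl : k ≠ l) (hall : ∀ m, m = i ∨ m = j ∨ m = k ∨ m = l)
      (hQ : ∀ k l : Fin 4, k ≠ i → k ≠ j → k ≠ l → (∀ m, m = i ∨ m = j ∨ m = k ∨ m = l) →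
        ∀ t t' : R, t ∈ S i → t ∈ S j → t' ∈ S i → t' ∈ S j → t ∉ S k → t' ∉ S k → t - t' ∈ S k)
      (f g : R →+ ZMod 2) (hf : ∀ x, f x = 0 ↔ x ∈ S i)
      (hg : ∀ x, g x = 0 ↔ x ∈ S j) (hf' : ∃ φ w u, IsGaloisCoordinate f φ w u)
      (hg' : ∃ χ : R →+* ZMod 2, ∀ x y, g (x * y) = χ x * g y + g x * χ y) :
      HasQuotientIso R (GaloisField 2 2 × GaloisField 2 2) := by
    have hf'' := hf'
    have hg'' := hg'
    obtain ⟨φ, w, u, h⟩ := hf''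
    obtain ⟨χ, hχ⟩ := hg''
    -- An element lying only in `S k` has f = g = 1; adding 1 adjusts χ and leaves f and g
    -- unchanged.
    obtain ⟨x, hfx, hgx, hχx⟩ : ∃ x, f x = 1 ∧ g x = 1 ∧ χ x = 1 := by
      obtain ⟨y, hy⟩ := hirr k
      have e1 := (ZMod.two_cases (f y)).resolve_left fun e => hy i hki.symm ((hf y).1 e)
      have e2 := (ZMod.two_cases (g y)).resolve_left fun e => hy j hkj.symm ((hg y).1 e)
      rcases ZMod.two_cases (χ y) with e3 | e3
      · refine ⟨y + 1, ?_, ?_, ?_⟩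
        · rw [map_add, e1, (hf 1).2 (one_mem i), add_zero]
        · rw [map_add, e2, (hg 1).2 (one_mem j), add_zero]
        · rw [map_add, e3, map_one, zero_add]
      · exact ⟨y, e1, e2, e3⟩
    have finish (k l : Fin 4) (hki : k ≠ i) (hkj : k ≠ j) (hkl : k ≠ l)
        (hall : ∀ m, m = i ∨ m = j ∨ m = k ∨ m = l) (hxk : x ∈ S k) :
        HasQuotientIso R (GaloisField 2 2 × GaloisField 2 2) := by
      -- Thus R = S k + (ker φ ∩ ker g) with the second summand inside S i ∩ S j, so `hQ` extends to
      -- all of R and `S k` has index 2.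
      have gen := exists_mem_sub_mem_ker h hχ hfx hgx hχx hxk (one_mem k)
      have hker (c : R) (hc : φ c = 0) : c ∈ S i := by
        refine (hf c).1 ?_
        by_contra hne
        have := h.root hne
        rw [hc] at this
        simp at this
      have diff (r r' : R) (hr : r ∉ S k) (hr' : r' ∉ S k) : r - r' ∈ S k := by
        obtain ⟨s, hs, h1, h2⟩ := gen r
        obtain ⟨s', hs', h1', h2'⟩ := gen r'
        have := hQ k l hki hkj hkl hall (r - s) (r' - s') (hker _ h1) ((hg _).1 h2) (hker _ h1')
          ((hg _).1 h2') (fun h => hr (by simpa using (S k).add_mem h hs))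
          (fun h => hr' (by simpa using (S k).add_mem h hs'))
        have := (S k).add_mem this ((S k).sub_mem hs hs')
        convert this using 1
        abel
      have hk : (S k).toAddSubgroup.index = 2 := by
        obtain ⟨a, ha⟩ : ∃ a, a ∉ S k := by
          by_contra! H
          exact hS k (eq_top_iff.2 fun x _ => H x)
        refine AddSubgroup.index_eq_two_iff.2 ⟨a, fun b => ?_⟩
        by_cases hb : b ∈ S k
        · exact Or.inr ⟨hb, fun h => ha (by simpa using (S k).sub_mem h hb)⟩
        · refine Or.inl ⟨?_, hb⟩
          have := diff b (-a) hb fun h => ha (by simpa using (S k).neg_mem h)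
          rwa [sub_neg_eq_add] at this
      obtain ⟨f', hf₁⟩ := functional k hk
      rcases kind k f' hf₁ with h | h
      · exact (der_der k j hkj f' g hf₁ hg h hg').elim
      · exact gal_gal k i hki f' f hf₁ hf h hf'
    obtain ⟨m, hm⟩ := hc x
    rcases hall m with rfl | rfl | rfl | rfl
    · rw [← hf, hfx] at hm
      exact absurd hm one_ne_zero
    · rw [← hg, hgx] at hm
      exact absurd hm one_ne_zero
    · exact finish m l hki hkj hkl hall hm
    · exact finish m k hli hlj hkl.symm (fun n => by
        rcases hall n with h | h | h | h <;> simp [h]) hm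
  obtain ⟨f, hf⟩ := functional i hi
  obtain ⟨g, hg⟩ := functional j hj
  rcases kind i f hf with hf' | hf' <;> rcases kind j g hg with hg' | hg'
  · exact (der_der i j hij f g hf hg hf' hg').elim
  · refine mixed j i k l hkj hki hlj hli hkl (fun m => by
      rcases hall m with h | h | h | h <;> simp [h]) ?_ g f hg hf hg' hf'
    intro k l h1 h2 h3 h4 t t' a b c d
    exact hQ k l h2 h1 h3 (fun m => by rcases h4 m with h | h | h | h <;> simp [h]) t t' b a d c
  · exact mixed i j k l hki hkj hli hlj hkl hall hQ f g hf hg hf' hg'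
  · exact gal_gal i j hij f g hf hg hf' hg'

end TwoIndexTwo

theorem mainTheorem2 (R : Type*) [Ring R] :
    coveringNumber R = 4 ↔
      coveringNumber R ≠ 3 ∧
        (HasQuotientIso R (GaloisField 2 2 × GaloisField 2 2) ∨
          HasQuotientIso R (Matrix (Fin 2) (Fin 2) (ZMod 2)) ∨
          HasQuotientIso R (TruncatedPolynomialTwo (ZMod 3)) ∨
          HasQuotientIso R (UpperTriangularTwo (ZMod 3))) := by
  constructor
  · intro h
    refine ⟨by rw [h]; decide, ?_⟩
    have hno : ¬ HasThreeCover R := fun H => by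
      have := H.coveringNumber_le
      rw [h] at this
      exact absurd this (by decide)
    obtain ⟨S₀, hS₀, hc₀⟩ := exists_cover_of_coveringNumber_eq (n := 4) h
    choose S hle hS hone using fun i => exists_proper_one_mem_or_complement (S₀ i) (hS₀ i)
    have hc (x) : ∃ i, x ∈ S i := (hc₀ x).imp fun i hi => hle i hi
    have hirr := irredundant_of_not_hasThreeCover hno S hS
    rcases index_of_irredundant_four_cover (fun i => (S i).toAddSubgroup) hc hirr with
      ⟨i, j, hij, hi, hj⟩ | h3
    · exact (hasQuotientIso_of_two_index_two hno hS hc hirr hone hij hi hj).imp id Or.inl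
    · exact Or.inr (Or.inr (hasQuotientIso_of_index_three hS hc hirr h3))
  · rintro ⟨h3, h⟩
    have hle : coveringNumber R ≤ 4 := by
      rcases h with h | h | h | h
      · exact coveringNumber_le_four_of_galoisField h
      · exact coveringNumber_le_four_of_matrix h
      · exact coveringNumber_le_four_of_truncated h
      · exact coveringNumber_le_four_of_upperTriangular h
    refine le_antisymm hle ?_
    have := Order.add_one_le_of_lt (lt_of_le_of_ne three_le_coveringNumber (Ne.symm h3))
    rwa [show (3 : ℕ∞) + 1 = 4 by norm_num] at this
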